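/- Let $p$ be an odd prime and $n = 2(p-1)$, let $F_n$ be the free group on $n$ letters and $\Sigma_p$ the symmetric group on $p$ letters, and let $\mathbb{Z}/p \le \Sigma_p$ be the subgroup generated by the cycle $(1\,2\,\dots\,p)$, with normalizer $N_{\Sigma_p}(\mathbb{Z}/p)$. Let $\Theta_{p-1}$ be the graph with two vertices and $p$ edges, each of which joins the two vertices. Glue two copies of $\Theta_{p-1}$ along one vertex $m$, and call the other vertices $y$ and $z$. Let $\Omega_n$ be the resulting graph with basepoint $y$, and let $\Psi_n$ be the same graph with basepoint $m$. Then the fundamental groups of $\Omega_n$ and $\Psi_n$ at their basepoints are free of rank $n$. Let $R \cong \mathbb{Z}/p \times \mathbb{Z}/p$ be the group of automorphisms of this graph in which the first factor cyclically rotates the $p$ edges of one copy of $\Theta_{p-1}$, the second factor cyclically rotates the $p$ edges of the other copy, and all vertices are fixed. Any marking of $\Omega_n$, that is, an isomorphism $\mu : F_n \to \pi_1(\Omega_n, y)$, turns a basepoint preserving graph automorphism $\sigma$ into the automorphism $\mu^{-1}\sigma_\#\mu$ of $F_n$. Let $D \le \mathrm{Aut}(F_n)$ be the image of $R$ under this homomorphism;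 let $E \le \mathrm{Aut}(F_n)$ be defined in the same way from $R$ and a marking of $\Psi_n$. For every choice of the markings, the normalizers $N_{\mathrm{Aut}(F_n)}(D)$ and $N_{\mathrm{Aut}(F_n)}(E)$ are finite. They consist of graph automorphisms: $N_{\mathrm{Aut}(F_n)}(D)$ (respectively $N_{\mathrm{Aut}(F_n)}(E)$) is the image of the normalizer of $R$ in the group of basepoint preserving graph automorphisms of $\Omega_n$ (respectively $\Psi_n$). Moreover $$N_{\mathrm{Aut}(F_n)}(D) \cong N_{\Sigma_p}(\mathbb{Z}/p) \times N_{\Sigma_p}(\mathbb{Z}/p),$$ $$N_{\mathrm{Aut}(F_n)}(E) \cong \bigl(N_{\Sigma_p}(\mathbb{Z}/p) \times N_{\Sigma_p}(\mathbb{Z}/p)\bigr) \rtimes \mathbb{Z}/2,$$ where $\mathbb{Z}/2$ acts by exchanging the two factors. -/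

import Mathlib

namespace AutFree

/-! ### Basepointed graphs and their fundamental groups -/

/-- A basepointed graph (one-dimensional CW complex) in the sense of Serre: `E` is the set of
oriented edges, `init e` is the initial vertex of `e`, and `rev e` is `e` with the opposite
orientation. Loops and multiple edges are allowed. -/
structure PointedGraph where
  V : Type
  E : Type
  init : E → V
  rev : E → E
  rev_rev : ∀ e, rev (rev e) = e
  rev_ne : ∀ e, rev e ≠ e
  base : V

namespace PointedGraph

variable (Γ : PointedGraph)

/-- The terminal vertex of an oriented edge. -/
def term (e : Γ.E) : Γ.V := Γ.init (Γ.rev e)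

/-- `Γ.IsPath v w l`: the list `l` of oriented edges is an edge path from `v` to `w`. -/
inductive IsPath : Γ.V → Γ.V → List Γ.E → Prop
  | nil (v : Γ.V) : IsPath v v []
  | cons (e : Γ.E) {w : Γ.V} {l : List Γ.E} (h : IsPath (Γ.term e) w l) :
      IsPath (Γ.init e) w (e :: l)

/-- The group generated by the oriented edges, with the relations `e * ē = 1`. -/
abbrev EdgeGroup : Type :=
  PresentedGroup (Set.range fun e : Γ.E => FreeGroup.of e * FreeGroup.of (Γ.rev e))

/-- An oriented edge as an element of the edge group. -/
def edge (e : Γ.E) : Γ.EdgeGroup := PresentedGroup.of e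

/-- The element of the edge group spelled by a list of oriented edges. -/
def word (l : List Γ.E) : Γ.EdgeGroup := (l.map Γ.edge).prod

variable {Γ}

theorem edge_mul_edge_rev (e : Γ.E) : Γ.edge e * Γ.edge (Γ.rev e) = 1 :=
  PresentedGroup.one_of_mem (rels := Set.range fun e : Γ.E =>
    FreeGroup.of e * FreeGroup.of (Γ.rev e)) ⟨e, rfl⟩

theorem edge_rev (e : Γ.E) : Γ.edge (Γ.rev e) = (Γ.edge e)⁻¹ :=
  eq_inv_of_mul_eq_one_right (edge_mul_edge_rev e)

theorem IsPath.append {u v w : Γ.V} {l m : List Γ.E} (hl : Γ.IsPath u v l)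
    (hm : Γ.IsPath v w m) : Γ.IsPath u w (l ++ m) := by
  induction hl with
  | nil => exact hm
  | cons e _ ih => exact IsPath.cons e (ih hm)

theorem IsPath.reverse {u v : Γ.V} {l : List Γ.E} (hl : Γ.IsPath u v l) :
    Γ.IsPath v u (l.map Γ.rev).reverse := by
  induction hl with
  | nil v => exact IsPath.nil v
  | @cons e w l _ ih =>
    have h : Γ.IsPath (Γ.init (Γ.rev e)) (Γ.init e) [Γ.rev e] := by
      apply IsPath.cons
      rw [term, Γ.rev_rev]
      exact IsPath.nil _
    simpa using ih.append h

theorem word_append (l m : List Γ.E) : Γ.word (l ++ m) = Γ.word l * Γ.word m := by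
  simp [word]

theorem word_reverse (l : List Γ.E) : Γ.word (l.map Γ.rev).reverse = (Γ.word l)⁻¹ := by
  induction l with
  | nil => simp [word]
  | cons e l ih =>
    rw [List.map_cons, List.reverse_cons, word_append, ih]
    simp [word, edge_rev]

variable (Γ)

/-- The fundamental group of `Γ` at the basepoint, in Serre's form: closed edge paths at the
basepoint modulo the relations `e ē = 1`. Two edge paths with the same end points are homotopic
exactly when they spell the same element of the edge group, so that the homotopy classes of closed
edge paths at the basepoint form the following subgroup of the edge group. -/
def pi1 : Subgroup Γ.EdgeGroup where
  carrier := {g | ∃ l, Γ.IsPath Γ.base Γ.base l ∧ Γ.word l = g}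
  one_mem' := ⟨[], IsPath.nil _, rfl⟩
  mul_mem' := by
    rintro _ _ ⟨l, hl, rfl⟩ ⟨m, hm, rfl⟩
    exact ⟨l ++ m, hl.append hm, word_append l m⟩
  inv_mem' := by
    rintro _ ⟨l, hl, rfl⟩
    exact ⟨(l.map Γ.rev).reverse, hl.reverse, word_reverse l⟩

/-- The group of basepoint preserving graph automorphisms of `Γ`: pairs of a permutation of the
vertices and a permutation of the oriented edges that are compatible with `init` and `rev`
and fix the basepoint. -/
def autGroup : Subgroup (Equiv.Perm Γ.V × Equiv.Perm Γ.E) where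
  carrier := {σ | (∀ e, Γ.init (σ.2 e) = σ.1 (Γ.init e)) ∧
    (∀ e, Γ.rev (σ.2 e) = σ.2 (Γ.rev e)) ∧ σ.1 Γ.base = Γ.base}
  one_mem' := ⟨fun _ => rfl, fun _ => rfl, rfl⟩
  mul_mem' := by
    rintro σ τ ⟨h1, h2, h3⟩ ⟨k1, k2, k3⟩
    refine ⟨fun e => ?_, fun e => ?_, ?_⟩
    · simp [h1, k1]
    · simp [h2, k2]
    · simp [h3, k3]
  inv_mem' := by
    rintro σ ⟨h1, h2, h3⟩
    refine ⟨fun e => ?_, fun e => ?_, ?_⟩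
    · apply σ.1.injective
      simp [← h1]
    · apply σ.2.injective
      simp [← h2]
    · apply σ.1.injective
      simp [h3]

variable {Γ}

/-- The endomorphism of the edge group induced by a graph automorphism. -/
def edgeMap (σ : Γ.autGroup) : Γ.EdgeGroup →* Γ.EdgeGroup :=
  PresentedGroup.toGroup (f := fun e => Γ.edge (σ.1.2 e)) (by
    rintro _ ⟨e, rfl⟩
    rw [map_mul, FreeGroup.lift_apply_of, FreeGroup.lift_apply_of, ← σ.2.2.1 e]
    exact edge_mul_edge_rev _)

theorem edgeMap_edge (σ : Γ.autGroup) (e : Γ.E) :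
    edgeMap σ (Γ.edge e) = Γ.edge (σ.1.2 e) :=
  PresentedGroup.toGroup.of _

theorem edgeMap_word (σ : Γ.autGroup) (l : List Γ.E) :
    edgeMap σ (Γ.word l) = Γ.word (l.map σ.1.2) := by
  simp [word, map_list_prod, Function.comp_def, edgeMap_edge]

theorem edgeMap_one (g : Γ.EdgeGroup) : edgeMap (1 : Γ.autGroup) g = g := by
  have : edgeMap (1 : Γ.autGroup) = MonoidHom.id _ :=
    PresentedGroup.ext fun e => edgeMap_edge 1 e
  rw [this, MonoidHom.id_apply]

theorem edgeMap_mul (σ τ : Γ.autGroup) (g : Γ.EdgeGroup) :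
    edgeMap (σ * τ) g = edgeMap σ (edgeMap τ g) := by
  have : edgeMap (σ * τ) = (edgeMap σ).comp (edgeMap τ) := PresentedGroup.ext fun e => by
    change edgeMap (σ * τ) (Γ.edge e) = edgeMap σ (edgeMap τ (Γ.edge e))
    rw [edgeMap_edge, edgeMap_edge, edgeMap_edge]
    rfl
  rw [this, MonoidHom.comp_apply]

theorem IsPath.map (σ : Γ.autGroup) {u v : Γ.V} {l : List Γ.E} (hl : Γ.IsPath u v l) :
    Γ.IsPath (σ.1.1 u) (σ.1.1 v) (l.map σ.1.2) := by
  induction hl with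
  | nil v => exact IsPath.nil _
  | cons e _ ih =>
    rw [← σ.2.1 e]
    apply IsPath.cons
    rwa [term, σ.2.2.1 e, σ.2.1]

theorem edgeMap_mem (σ : Γ.autGroup) {g : Γ.EdgeGroup} (hg : g ∈ Γ.pi1) :
    edgeMap σ g ∈ Γ.pi1 := by
  obtain ⟨l, hl, rfl⟩ := hg
  refine ⟨l.map σ.1.2, ?_, (edgeMap_word σ l).symm⟩
  simpa only [σ.2.2.2] using hl.map σ

variable (Γ)

/-- The action of the basepoint preserving graph automorphisms on the fundamental group,
`σ ↦ σ_#`. -/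
def pi1Action : Γ.autGroup →* MulAut Γ.pi1 where
  toFun σ :=
    { toFun := fun g => ⟨edgeMap σ g, edgeMap_mem σ g.2⟩
      invFun := fun g => ⟨edgeMap σ⁻¹ g, edgeMap_mem σ⁻¹ g.2⟩
      left_inv := fun g => Subtype.ext (by
        change edgeMap σ⁻¹ (edgeMap σ g) = g
        rw [← edgeMap_mul, inv_mul_cancel, edgeMap_one])
      right_inv := fun g => Subtype.ext (by
        change edgeMap σ (edgeMap σ⁻¹ g) = g
        rw [← edgeMap_mul, mul_inv_cancel, edgeMap_one])
      map_mul' := fun g h => Subtype.ext (map_mul (edgeMap σ) (g : Γ.EdgeGroup) h) }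
  map_one' := MulEquiv.ext fun g => Subtype.ext (edgeMap_one (g : Γ.EdgeGroup))
  map_mul' σ τ := MulEquiv.ext fun g => Subtype.ext (edgeMap_mul σ τ (g : Γ.EdgeGroup))

/-- A marking of `Γ` by the rose with `n` petals, up to equivalence: an isomorphism from the free
group `F_n` to the fundamental group of `Γ` at the basepoint. -/
abbrev Marking (n : ℕ) : Type := FreeGroup (Fin n) ≃* Γ.pi1

variable {Γ}

/-- A marking turns basepoint preserving graph automorphisms into automorphisms of `F_n`:
`σ ↦ μ⁻¹ ∘ σ_# ∘ μ`. -/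
def Marking.realize {n : ℕ} (μ : Γ.Marking n) : Γ.autGroup →* MulAut (FreeGroup (Fin n)) :=
  (MulAut.congr μ.symm).toMonoidHom.comp Γ.pi1Action

end PointedGraph

/-! ### The graphs `Ω` and `Ψ` -/

/-- The vertices of two Θ-graphs that share one vertex: the common vertex `mid`, and the other
vertex `tip s` of each of the two Θ-graphs. -/
inductive Vertex
  | mid
  | tip (s : Bool)

/-- Two Θ-graphs, each with `p` edges, that share the vertex `mid`. The edge `(s, i, false)` is
the `i`-th edge of the Θ-graph number `s`, oriented from `mid` to `tip s`; `(s, i, true)` is the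
same edge with the opposite orientation. The basepoint is left open. -/
abbrev doubleTheta (p : ℕ) (b : Vertex) : PointedGraph where
  V := Vertex
  E := Bool × Fin p × Bool
  init e := if e.2.2 then Vertex.tip e.1 else Vertex.mid
  rev e := (e.1, e.2.1, !e.2.2)
  rev_rev e := by simp
  rev_ne e h := by simpa using congrArg (fun x => x.2.2) h
  base := b

/-- `Ω`: the basepoint is an end vertex of the chain of the two Θ-graphs. -/
abbrev Omega (p : ℕ) : PointedGraph := doubleTheta p (Vertex.tip false)

/-- `Ψ`: the basepoint is the common vertex of the two Θ-graphs. -/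
abbrev Psi (p : ℕ) : PointedGraph := doubleTheta p Vertex.mid

/-- The action of `Σ_p × Σ_p` on the two Θ-graphs: each factor permutes the edges of one Θ-graph,
and all vertices are fixed. -/
def permuteEdges (p : ℕ) (b : Vertex) :
    Equiv.Perm (Fin p) × Equiv.Perm (Fin p) →* (doubleTheta p b).autGroup where
  toFun σ := ⟨(1,
    { toFun := fun e : Bool × Fin p × Bool =>
        (e.1, (if e.1 then σ.2 e.2.1 else σ.1 e.2.1), e.2.2)
      invFun := fun e : Bool × Fin p × Bool =>
        (e.1, (if e.1 then σ.2⁻¹ e.2.1 else σ.1⁻¹ e.2.1), e.2.2)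
      left_inv := by rintro ⟨_ | _, i, o⟩ <;> simp
      right_inv := by rintro ⟨_ | _, i, o⟩ <;> simp }),
    fun _ => rfl, fun _ => rfl, rfl⟩
  map_one' := by
    apply Subtype.ext
    refine Prod.ext rfl (Equiv.ext ?_)
    rintro ⟨_ | _, i, o⟩ <;> rfl
  map_mul' σ τ := by
    apply Subtype.ext
    refine Prod.ext rfl (Equiv.ext ?_)
    rintro ⟨_ | _, i, o⟩ <;> rfl

/-- The subgroup `ℤ/p` of the symmetric group `Σ_p` generated by the `p`-cycle `(1 2 … p)`. -/
def cyclicSubgroup (p : ℕ) : Subgroup (Equiv.Perm (Fin p)) :=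
  Subgroup.zpowers (finRotate p)

/-- `N_{Σ_p}(ℤ/p)`. -/
def normCyclic (p : ℕ) : Subgroup (Equiv.Perm (Fin p)) :=
  Subgroup.normalizer (cyclicSubgroup p : Set (Equiv.Perm (Fin p)))

/-- The group `ℤ/p × ℤ/p` of graph automorphisms, the first factor rotating one of the Θ-graphs
and the second factor rotating the other one. -/
def rotations (p : ℕ) (b : Vertex) : Subgroup (doubleTheta p b).autGroup :=
  ((cyclicSubgroup p).prod (cyclicSubgroup p)).map (permuteEdges p b)

/-- The subgroup `D` of `Aut(F_n)`, for a given marking of `Ω`. -/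
def subgroupD (p : ℕ) {n : ℕ} (μ : (Omega p).Marking n) :
    Subgroup (MulAut (FreeGroup (Fin n))) :=
  (rotations p (Vertex.tip false)).map μ.realize

/-- The subgroup `E` of `Aut(F_n)`, for a given marking of `Ψ`. -/
def subgroupE (p : ℕ) {n : ℕ} (μ : (Psi p).Marking n) :
    Subgroup (MulAut (FreeGroup (Fin n))) :=
  (rotations p Vertex.mid).map μ.realize

/-- The action of `ℤ/2` on `H × H` that exchanges the two factors. -/
def swapAction (H : Type*) [Group H] : Multiplicative (ZMod 2) →* MulAut (H × H) where
  toFun a := if a = 1 then 1 else MulEquiv.prodComm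
  map_one' := if_pos rfl
  map_mul' a b := by
    have key : ∀ a b : Multiplicative (ZMod 2), (a = 1 ∧ b = 1 ∧ a * b = 1) ∨
        (a = 1 ∧ b ≠ 1 ∧ a * b ≠ 1) ∨ (a ≠ 1 ∧ b = 1 ∧ a * b ≠ 1) ∨
        (a ≠ 1 ∧ b ≠ 1 ∧ a * b = 1) := by decide
    rcases key a b with ⟨h1, h2, h3⟩ | ⟨h1, h2, h3⟩ | ⟨h1, h2, h3⟩ | ⟨h1, h2, h3⟩ <;>
      simp only [h1, h2, h3, if_true, if_false, one_mul, mul_one]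
    rfl

end AutFree

/-! The edge group is free on the unoriented edges and contains the fundamental group as a subgroup.
A pair of permutations of the two edge sets acts by permuting letters, so an element of the
fundamental group is fixed only if every letter of its reduced word is fixed. This determines the
fixed subgroups of the elements of `R`, which a normalizing automorphism `φ` must permute.

At `mid` the fundamental group is the free product of the loops in the two Θ-graphs. The rotation of
one graph fixes exactly the loops of the other, and an element of `R` nontrivial in both factors
fixes nothing. Hence `φ` preserves or exchanges the two factors of `R`. After composition with the
exchange and with a pair of permutations, `φ` commutes with both rotations and preserves both free
factors.

At `tip false` an element of `R` that rotates the near graph fixes nothing, since a nontrivial loop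
must use a near edge. Hence `φ` preserves the factor rotating the far graph and its fixed subgroup,
the near loops. Once `φ` is corrected to be the identity there, the far loops are recognized because
the near rotation acts on them as conjugation by a near loop.

Both cases end with the rigidity `exists_eq_map_pow_of_equivariant`: a surjective endomorphism of
the group of a Θ-graph that commutes with the rotation is a power of it. Vanishing of a first
cohomology set (`exists_eq_mul_map_inv`) puts it in the form `x y⁻¹ ↦ (u_x h)(u_y h)⁻¹`, where `u_x`
is the power of the rotation taking the base letter to `x`. Images of reduced products then do not
cancel, and surjectivity forces `h` to be one letter.

So the normalizer lies in the image of the graph automorphisms. These act faithfully, and what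
remains is a normalizer in a finite group of graph automorphisms. -/

namespace FreeGroup

/-! ### Reduced words under maps of the letters -/

variable {X Y : Type*}

/-- The map on words induced by a map of the letters. -/
def mapWord (f : X → Y) (L : List (X × Bool)) : List (Y × Bool) :=
  L.map fun x => (f x.1, x.2)

theorem IsReduced.mapWord {f : X → Y} (hf : Function.Injective f) {L : List (X × Bool)}
    (h : IsReduced L) : IsReduced (mapWord f L) := by
  refine (List.isChain_map _).2 (h.imp ?_)
  intro a b hab hf'
  exact hab (hf hf')

theorem map_mk_eq (f : X → Y) (L : List (X × Bool)) : map f (mk L) = mk (mapWord f L) := rfl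

theorem toWord_mk_of_isReduced [DecidableEq X] {L : List (X × Bool)} (h : IsReduced L) :
    (mk L).toWord = L := by
  rw [toWord_mk, h.reduce_eq]

theorem toWord_map [DecidableEq X] [DecidableEq Y] {f : X → Y} (hf : Function.Injective f)
    (w : FreeGroup X) : (map f w).toWord = mapWord f w.toWord := by
  conv_lhs => rw [← mk_toWord (x := w), map_mk_eq]
  exact toWord_mk_of_isReduced (isReduced_toWord.mapWord hf)

/-- A permutation of the letters maps reduced words to reduced words, so invariance of `w` is
invariance of its word, position by position. -/
theorem letter_fixed_of_map_eq [DecidableEq X] {c : Equiv.Perm X} {w : FreeGroup X}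
    (h : map c w = w) {x : X × Bool} (hx : x ∈ w.toWord) : c x.1 = x.1 := by
  have h1 := toWord_map c.injective w
  rw [h] at h1
  have h2 : List.map id w.toWord = w.toWord.map fun x => (c x.1, x.2) := by
    rw [List.map_id]; exact h1
  have h3 := List.map_inj_left.1 h2 x hx
  exact (congrArg Prod.fst h3).symm

theorem mem_range_map_of_toWord [DecidableEq X] {f : Y → X} {w : FreeGroup X}
    (h : ∀ x ∈ w.toWord, x.1 ∈ Set.range f) : w ∈ (map f).range := by
  rw [← mk_toWord (x := w)]
  generalize w.toWord = L at h
  induction L with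
  | nil => exact one_mem _
  | cons a L ih =>
    have : mk (a :: L) = mk [a] * mk L := by simp
    rw [this]
    refine mul_mem ?_ (ih fun x hx => h x (List.mem_cons_of_mem _ hx))
    obtain ⟨y, hy⟩ := h a List.mem_cons_self
    exact ⟨mk [(y, a.2)], by rw [map.mk]; simp [hy]⟩

theorem eq_one_of_map_eq {c : Equiv.Perm X} (hc : ∀ x, c x ≠ x) {w : FreeGroup X}
    (h : map c w = w) : w = 1 := by
  classical
  rw [← toWord_eq_nil_iff, List.eq_nil_iff_forall_not_mem]
  exact fun x hx => hc _ (letter_fixed_of_map_eq h hx)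

/-! ### Vanishing of the first cohomology of a permutation action on a free group -/

/-- The product `g * c g * c² g * ⋯ * cⁿ⁻¹ g`. -/
def cocycleProd (c : Equiv.Perm X) (g : FreeGroup X) : ℕ → FreeGroup X
  | 0 => 1
  | n + 1 => g * map c (cocycleProd c g n)

theorem map_perm_mul (c d : Equiv.Perm X) (w : FreeGroup X) :
    map (c * d : Equiv.Perm X) w = map c (map d w) := by
  rw [map.comp]; rfl

/-- Passing to a cohomologous cocycle makes the product telescope; only the two outer factors
survive. -/
theorem cocycleProd_conj (c : Equiv.Perm X) (g h : FreeGroup X) (n : ℕ) :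
    cocycleProd c (h⁻¹ * g * map c h) n =
      h⁻¹ * cocycleProd c g n * map (c ^ n : Equiv.Perm X) h := by
  induction n with
  | zero => simp [cocycleProd]
  | succ n ih =>
    rw [cocycleProd, ih, cocycleProd, pow_succ', map_perm_mul]
    simp only [_root_.map_mul, _root_.map_inv]
    group

/-- The word `L ++ c L ++ c² L ++ ⋯`. -/
def cocycleWord (c : Equiv.Perm X) (L : List (X × Bool)) : ℕ → List (X × Bool)
  | 0 => []
  | n + 1 => L ++ mapWord c (cocycleWord c L n)

theorem mk_cocycleWord (c : Equiv.Perm X) (L : List (X × Bool)) (n : ℕ) :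
    mk (cocycleWord c L n) = cocycleProd c (mk L) n := by
  induction n with
  | zero => rfl
  | succ n ih => rw [cocycleWord, cocycleProd, ← ih, map_mk_eq, mul_mk]

/-- The hypothesis `h` says that the last letter of `L` does not cancel against the first letter of
`c L`; every later junction is a translate of this one. -/
theorem isReduced_cocycleWord {c : Equiv.Perm X} {L : List (X × Bool)} (hL : IsReduced L)
    (hne : L ≠ []) (h : ∀ a ∈ L.getLast?, ∀ b ∈ L.head?, a.1 = c b.1 → a.2 = b.2) (n : ℕ) :
    IsReduced (cocycleWord c L n) := by
  induction n with
  | zero => exact IsReduced.nil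
  | succ n ih =>
    refine List.IsChain.append hL (ih.mapWord c.injective) ?_
    intro a ha b hb
    cases n with
    | zero => simp [cocycleWord, mapWord] at hb
    | succ n =>
      obtain ⟨z, L', rfl⟩ := List.exists_cons_of_ne_nil hne
      simp only [cocycleWord, mapWord, List.cons_append, List.map_cons, List.head?_cons,
        Option.mem_some_iff] at hb
      subst hb
      exact h a ha z rfl

/-- Induction on the length of `g`, a twisted form of cyclic reduction: either `g` and `c g` meet
without cancellation, or a twisted conjugation by the first letter shortens `g`. -/
theorem exists_eq_mul_map_inv {c : Equiv.Perm X} {N : ℕ} (hN : 0 < N) (hc : c ^ N = 1)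
    (g : FreeGroup X) (hg : cocycleProd c g N = 1) : ∃ h, g = h * (map c h)⁻¹ := by
  classical
  induction hk : g.toWord.length using Nat.strong_induction_on generalizing g with
  | _ k ih =>
  have hred : IsReduced g.toWord := isReduced_toWord
  by_cases hne : g.toWord = []
  · exact ⟨1, by simpa using hne⟩
  by_cases h : ∀ a ∈ g.toWord.getLast?, ∀ b ∈ g.toWord.head?, a.1 = c b.1 → a.2 = b.2
  -- Without cancellation `g * c g * ⋯` is spelled by a nonempty reduced word, although its value is
  -- `1`.
  · exfalso
    have h1 := isReduced_cocycleWord hred hne h N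
    rw [isReduced_iff_reduce_eq, ← toWord_mk, mk_cocycleWord, mk_toWord, hg, toWord_one] at h1
    obtain ⟨N, rfl⟩ := Nat.exists_eq_succ_of_ne_zero hN.ne'
    exact hne (List.append_eq_nil_iff.1 h1.symm).1
  · push Not at h
    obtain ⟨a, ha, b, hb, hab, hab'⟩ := h
    obtain ⟨L', hL'⟩ : ∃ L', g.toWord = b :: L' := by
      obtain ⟨z, L', h'⟩ := List.exists_cons_of_ne_nil hne
      rw [h'] at hb
      simp only [List.head?_cons, Option.mem_some_iff] at hb
      exact ⟨L', by rw [h', hb]⟩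
    -- A word of one letter has equal first and last letters, which contradicts the opposite signs;
    -- so first and last letter are at different positions.
    rcases List.eq_nil_or_concat L' with rfl | ⟨M, z, rfl⟩
    · rw [hL'] at ha
      simp only [List.getLast?_singleton, Option.mem_some_iff] at ha
      exact absurd (by rw [ha]) hab'
    · have hz : z = a := by
        rw [hL', List.concat_eq_append, ← List.cons_append, List.getLast?_append] at ha
        simpa using ha
      subst hz
      rw [List.concat_eq_append] at hL'
      have hz : z = (c b.1, !b.2) := by
        refine Prod.ext hab ?_
        change z.2 = !b.2
        revert hab'; cases z.2 <;> cases b.2 <;> simp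
      have e1 : g = mk [b] * mk M * mk [z] := by
        rw [mul_mk, mul_mk, ← mk_toWord (x := g), hL']; simp
      have e2 : mk [z] = (map c (mk [b]))⁻¹ := by
        rw [map_mk_eq, inv_mk, hz]; rfl
      have e3 : mk M = (mk [b])⁻¹ * g * map c (mk [b]) := by
        rw [e1, e2]; group
      have hlen : (mk M).toWord.length < k := by
        have := norm_mk_le (L₁ := M)
        rw [norm] at this
        rw [← hk, hL']
        simp only [List.length_cons, List.length_append]
        omega
      obtain ⟨h, hh⟩ := ih _ hlen (mk M) (by
        rw [e3, cocycleProd_conj, hg, hc]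
        rw [show ((1 : Equiv.Perm X) : X → X) = id from rfl, map.id]
        group) rfl
      refine ⟨mk [b] * h, ?_⟩
      rw [e1, e2, hh, _root_.map_mul]
      group

/-! ### Equivariant endomorphisms of the fundamental group of a Θ-graph -/

/-- The projection of the free group onto the subgroup generated by the quotients `x y⁻¹` of
letters, `x ↦ x x₀⁻¹`. -/
def relHom (x₀ : X) : FreeGroup X →* FreeGroup X :=
  lift fun x => of x * (of x₀)⁻¹

@[simp] theorem relHom_of (x₀ x : X) : relHom x₀ (of x) = of x * (of x₀)⁻¹ :=
  lift_apply_of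

/-- The product of the quotients `f x * (f y)⁻¹` over a list of pairs `(x, y)`. -/
def quotProd {G : Type*} [Group G] (f : X → G) (M : List (X × X)) : G :=
  (M.map fun q => f q.1 * (f q.2)⁻¹).prod

theorem quotProd_cons {G : Type*} [Group G] (f : X → G) (q : X × X) (M : List (X × X)) :
    quotProd f (q :: M) = f q.1 * (f q.2)⁻¹ * quotProd f M := by
  simp [quotProd]

/-- A list of pairs such that no two consecutive letters of `x₁ y₁⁻¹ x₂ y₂⁻¹ ⋯` cancel. -/
def IsReducedPairs (M : List (X × X)) : Prop :=
  M.IsChain (fun a b => a.2 ≠ b.1) ∧ ∀ q ∈ M, q.1 ≠ q.2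

/-- A new pair `(i, j)` in front of `(j, l)` merges into `(i, l)`, or disappears if `i = l`;
otherwise it is simply prepended. -/
theorem exists_isReducedPairs_mul (f : X → FreeGroup X) (i j : X) {M : List (X × X)}
    (hM : IsReducedPairs M) :
    ∃ M', IsReducedPairs M' ∧ quotProd f M' = f i * (f j)⁻¹ * quotProd f M := by
  classical
  by_cases hij : i = j
  · exact ⟨M, hM, by simp [hij]⟩
  rcases M with _ | ⟨⟨k, l⟩, M⟩
  · exact ⟨[(i, j)], ⟨List.isChain_singleton _, by simpa using hij⟩, by simp [quotProd]⟩
  by_cases hjk : j = k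
  · subst hjk
    have hM2 := hM.2
    simp only [List.mem_cons, forall_eq_or_imp] at hM2
    by_cases hil : i = l
    · subst hil
      refine ⟨M, ⟨(List.isChain_cons.1 hM.1).2, hM2.2⟩, ?_⟩
      rw [quotProd_cons]; group
    · refine ⟨(i, l) :: M, ⟨?_, ?_⟩, ?_⟩
      · exact List.isChain_cons.2 ⟨(List.isChain_cons.1 hM.1).1, (List.isChain_cons.1 hM.1).2⟩
      · simp only [List.mem_cons, forall_eq_or_imp]
        exact ⟨hil, hM2.2⟩
      · rw [quotProd_cons, quotProd_cons]; group
  · refine ⟨(i, j) :: (k, l) :: M, ⟨?_, ?_⟩, quotProd_cons _ _ _⟩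
    · exact List.isChain_cons_cons.2 ⟨hjk, hM.1⟩
    · rw [List.forall_mem_cons]
      exact ⟨hij, hM.2⟩

theorem exists_relHom_eq_quotProd (x₀ : X) (w : FreeGroup X) :
    ∃ M, IsReducedPairs M ∧ relHom x₀ w = quotProd of M := by
  classical
  rw [← mk_toWord (x := w)]
  generalize w.toWord = L
  induction L with
  | nil => exact ⟨[], ⟨List.isChain_nil, by simp⟩, by simp [quotProd, ← one_eq_mk]⟩
  | cons a L ih =>
    obtain ⟨M, hM, hw⟩ := ih
    have e : (mk (a :: L) : FreeGroup X) = mk [a] * mk L := by simp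
    obtain ⟨x, b⟩ := a
    cases b with
    | true =>
      obtain ⟨M', hM', h'⟩ := exists_isReducedPairs_mul of x x₀ hM
      refine ⟨M', hM', ?_⟩
      rw [h', e, _root_.map_mul, hw]
      congr 1
    | false =>
      obtain ⟨M', hM', h'⟩ := exists_isReducedPairs_mul of x₀ x hM
      refine ⟨M', hM', ?_⟩
      rw [h', e, _root_.map_mul, hw]
      have : (mk [(x, false)] : FreeGroup X) = (of x)⁻¹ := by simp [of, inv_mk, invRev]
      rw [this, _root_.map_inv, relHom_of]; group

/-- The word of the product of the `(u x) h * ((u y) h)⁻¹`, for the pairs `(x, y)` of a list. -/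
def pairWord (u : X → Equiv.Perm X) (L : List (X × Bool)) : List (X × X) → List (X × Bool)
  | [] => []
  | q :: M => mapWord (u q.1) L ++ (invRev (mapWord (u q.2) L) ++ pairWord u L M)

theorem mk_pairWord (u : X → Equiv.Perm X) (L : List (X × Bool)) (M : List (X × X)) :
    mk (pairWord u L M) = quotProd (fun x => map (u x) (mk L)) M := by
  induction M with
  | nil => rfl
  | cons q M ih =>
    rw [pairWord, quotProd_cons, ← ih, map_mk_eq, map_mk_eq, inv_mk, mul_mk, mul_mk,
      List.append_assoc]

theorem length_pairWord (u : X → Equiv.Perm X) (L : List (X × Bool)) (M : List (X × X)) :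
    (pairWord u L M).length = 2 * (M.length * L.length) := by
  induction M with
  | nil => simp [pairWord]
  | cons q M ih =>
    simp only [pairWord, List.length_append, invRev_length, ih, mapWord, List.length_map,
      List.length_cons]
    ring

/-- At each junction two translates of the same end letter of `L` meet, with opposite signs. By
`hu`, different indices give different translates, and `IsReducedPairs` makes the indices at a
junction different. -/
theorem isReduced_pairWord {u : X → Equiv.Perm X} (hu : ∀ i j z, u i z = u j z → i = j)
    {L : List (X × Bool)} (hL : IsReduced L) {M : List (X × X)} (hM : IsReducedPairs M) :
    IsReduced (pairWord u L M) := by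
  classical
  have hinv : ∀ q : X, IsReduced (invRev (mapWord (u q) L)) := fun q => by
    have h1 := hL.mapWord (u q).injective
    rw [isReduced_iff_reduce_eq] at h1 ⊢
    rw [reduce_invRev, h1]
  induction M with
  | nil => exact IsReduced.nil
  | cons q M ih =>
    have hq := hM.2 q List.mem_cons_self
    have hM' : IsReducedPairs M :=
      ⟨(List.isChain_cons.1 hM.1).2, fun q hq => hM.2 q (List.mem_cons_of_mem _ hq)⟩
    refine List.IsChain.append (hL.mapWord (u q.1).injective)
      (List.IsChain.append (hinv _) (ih hM') ?_) ?_
    · rcases M with _ | ⟨r, M⟩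
      · simp [pairWord]
      · rcases L with _ | ⟨z, L⟩
        · simp [invRev, mapWord]
        · intro a ha b hb
          simp only [invRev, mapWord, List.map_cons, List.reverse_cons, List.getLast?_append,
            List.getLast?_singleton, Option.some_or, Option.mem_some_iff] at ha
          simp only [pairWord, mapWord, List.map_cons, List.cons_append, List.head?_cons,
            Option.mem_some_iff] at hb
          subst ha hb
          intro h
          exact absurd (hu _ _ _ h) (List.isChain_cons_cons.1 hM.1).1
    · rcases List.eq_nil_or_concat L with rfl | ⟨L, z, rfl⟩
      · simp [mapWord]
      · intro a ha b hb
        rw [List.concat_eq_append] at ha hb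
        simp only [mapWord, List.map_append, List.map_cons, List.map_nil, List.getLast?_append,
          List.getLast?_singleton, Option.some_or, Option.mem_some_iff] at ha
        simp only [invRev, mapWord, List.map_append, List.map_cons, List.map_nil,
          List.reverse_append, List.reverse_cons, List.reverse_nil, List.nil_append,
          List.cons_append, List.head?_cons, Option.mem_some_iff] at hb
        subst ha hb
        intro h
        exact absurd (hu _ _ _ h) hq

theorem cocycleProd_one (c : Equiv.Perm X) (n : ℕ) : cocycleProd c 1 n = 1 := by
  induction n with
  | zero => rfl
  | succ n ih => simp [cocycleProd, ih]

theorem map_quotProd {G G' : Type*} [Group G] [Group G'] (φ : G →* G') (f : X → G)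
    (M : List (X × X)) : φ (quotProd f M) = quotProd (fun x => φ (f x)) M := by
  induction M with
  | nil => simp [quotProd]
  | cons q M ih => simp [quotProd_cons, ih]

theorem hom_relHom {G : Type*} [Group G] {x₀ : X} {θ : FreeGroup X →* G}
    (h1 : θ (of x₀) = 1) (w : FreeGroup X) : θ (relHom x₀ w) = θ w := by
  have : θ.comp (relHom x₀) = θ := ext_hom _ _ fun x => by simp [h1]
  exact DFunLike.congr_fun this w

/-- An equivariant endomorphism of the subgroup of the free group that is generated by the
quotients of letters is a power of the rotation, if it is surjective. -/
theorem exists_eq_map_pow_of_equivariant {c : Equiv.Perm X} {N : ℕ} (hN : 0 < N) (hc : c ^ N = 1)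
    (htrans : ∀ x y, ∃ n : ℕ, (c ^ n) x = y) {x₀ : X} {θ : FreeGroup X →* FreeGroup X}
    (h1 : θ (of x₀) = 1)
    (hθ : ∀ i j, θ (of (c i) * (of (c j))⁻¹) = map c (θ (of i * (of j)⁻¹)))
    {w₀ : FreeGroup X} (hw₀ : θ w₀ = of x₀ * (of (c x₀))⁻¹) (hx₀ : c x₀ ≠ x₀) :
    ∃ s : ℕ, ∀ w, θ w = map (c ^ s : Equiv.Perm X) (relHom x₀ w) := by
  classical
  set g := θ (of x₀ * (of (c x₀))⁻¹) with hg
  -- The images of `x₀ (cⁿ x₀)⁻¹` are the partial products of the cocycle defined by `g`; a full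
  -- period gives `1`.
  have hprod : ∀ n : ℕ, θ (of x₀ * (of ((c ^ n) x₀))⁻¹) = cocycleProd c g n := by
    intro n
    induction n with
    | zero => simp [cocycleProd]
    | succ n ih =>
      rw [cocycleProd, ← ih, hg, ← hθ, ← _root_.map_mul, pow_succ', Equiv.Perm.mul_apply]
      congr 1; group
  obtain ⟨h, hh⟩ := exists_eq_mul_map_inv hN hc g (by rw [← hprod, hc]; simp)
  have hcob : ∀ n : ℕ, cocycleProd c g n = h * (map (c ^ n : Equiv.Perm X) h)⁻¹ := by
    intro n
    have := cocycleProd_conj c 1 h⁻¹ n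
    rw [cocycleProd_one] at this
    simp only [inv_inv, mul_one, _root_.map_inv] at this
    rw [hh, this]
  choose k hk using fun x => htrans x₀ x
  have hu : ∀ i j z, (c ^ k i) z = (c ^ k j) z → i = j := by
    intro i j z hz
    obtain ⟨m, rfl⟩ := htrans x₀ z
    have e : ∀ l : ℕ, (c ^ l) ((c ^ m) x₀) = (c ^ m) ((c ^ l) x₀) := fun l => by
      rw [← Equiv.Perm.mul_apply, ← Equiv.Perm.mul_apply, ← pow_add, ← pow_add, add_comm]
    rw [e, e, hk, hk] at hz
    exact (c ^ m : Equiv.Perm X).injective hz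
  -- With `g = h (c h)⁻¹` the endomorphism is determined by the single element `h`.
  have hx : ∀ x, θ (of x) = map (c ^ k x : Equiv.Perm X) h * h⁻¹ := by
    intro x
    have := hprod (k x)
    rw [hk, _root_.map_mul, h1, one_mul, _root_.map_inv, hcob] at this
    rw [← inv_inj, this]; group
  obtain ⟨M, hM, hMw⟩ := exists_relHom_eq_quotProd x₀ w₀
  have hword : mk (pairWord (fun x => c ^ k x) h.toWord M) = of x₀ * (of (c x₀))⁻¹ := by
    rw [mk_pairWord, mk_toWord, ← hw₀, ← hom_relHom h1, hMw, map_quotProd]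
    simp only [quotProd, hx]
    congr 2; funext q; group
  have hlist : pairWord (fun x => c ^ k x) h.toWord M = [(x₀, true), (c x₀, false)] := by
    have e : (of x₀ * (of (c x₀))⁻¹ : FreeGroup X) = mk [(x₀, true), (c x₀, false)] := by
      simp [of, inv_mk, mul_mk, invRev]
    rw [e] at hword
    have := congrArg toWord hword
    rwa [toWord_mk_of_isReduced (isReduced_pairWord hu isReduced_toWord hM),
      toWord_mk_of_isReduced] at this
    exact isReduced_cons_cons.2 ⟨fun h => absurd h.symm hx₀, IsReduced.singleton⟩
  have hlen := congrArg List.length hlist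
  rw [length_pairWord] at hlen
  -- The reduced word has length `2 |M| |h|` and spells an element of length 2, so `M` is one pair
  -- and `h` one letter. Comparison of the first letters below shows that `h` is a positive letter.
  have hlen' : M.length * h.toWord.length = 1 := by simpa using hlen
  obtain ⟨hM1, hh1⟩ := mul_eq_one.1 hlen'
  obtain ⟨q, rfl⟩ := List.length_eq_one_iff.1 hM1
  obtain ⟨z, hz⟩ := List.length_eq_one_iff.1 hh1
  rw [hz] at hlist
  simp only [pairWord, mapWord, List.map_cons, List.map_nil, invRev, List.reverse_cons,
    List.reverse_nil, List.nil_append, List.append_nil, List.cons_append, List.cons.injEq,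
    Prod.mk.injEq] at hlist
  have hz' : h = of z.1 := by
    rw [← mk_toWord (x := h), hz]
    exact congrArg mk (congrArg (fun y => [y]) (Prod.ext rfl hlist.1.2))
  refine ⟨k z.1, fun w => ?_⟩
  have : θ = (map (c ^ k z.1 : Equiv.Perm X)).comp (relHom x₀) := by
    refine ext_hom _ _ fun x => ?_
    have e : (c ^ k x) z.1 = (c ^ k z.1) x := by
      conv_lhs => rw [← hk z.1]
      conv_rhs => rw [← hk x]
      rw [← Equiv.Perm.mul_apply, ← Equiv.Perm.mul_apply, ← pow_add, ← pow_add, add_comm]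
    rw [hx, hz']
    simp [e, hk]
  rw [this]; rfl

theorem relHom_relHom (x₀ : X) (w : FreeGroup X) : relHom x₀ (relHom x₀ w) = relHom x₀ w :=
  hom_relHom (by simp) w

theorem relHom_map_relHom (x₀ : X) (c : X → X) (w : FreeGroup X) :
    relHom x₀ (map c (relHom x₀ w)) = map c (relHom x₀ w) := by
  have : ((relHom x₀).comp (map c)).comp (relHom x₀) = (map c).comp (relHom x₀) :=
    ext_hom _ _ fun x => by simp
  exact DFunLike.congr_fun this w

/-- The rigidity of the rotation of a Θ-graph, transported to a group `P` that contains a copy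
(parametrized by `E`) of the fundamental group of the Θ-graph. -/
theorem exists_apply_eq_iterate_of_commute {P : Type*} [Group P] {c : Equiv.Perm X} {N : ℕ}
    (hN : 0 < N) (hc : c ^ N = 1) (htrans : ∀ x y, ∃ n : ℕ, (c ^ n) x = y) {x₀ : X}
    (hx₀ : c x₀ ≠ x₀) {E : FreeGroup X →* P} (hE1 : E (of x₀) = 1)
    (hE : ∀ h h', E h = E h' → relHom x₀ h = relHom x₀ h') {φ α : P →* P}
    (hEα : ∀ i, E (of (c i) * (of (c x₀))⁻¹) = α (E (of i))) (hφα : ∀ h, φ (α (E h)) = α (φ (E h)))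
    (hφE : ∀ h, ∃ h', E h' = φ (E h)) (hsurj : ∀ h, ∃ h', φ (E h') = E h) :
    ∃ s : ℕ, ∀ h, φ (E h) = α^[s] (E h) := by
  choose θ₀ hθ₀ using hφE
  -- The chosen preimages are unique only up to the kernel of `relHom x₀`; applying `relHom x₀`
  -- makes the choice canonical, hence multiplicative.
  let θ : FreeGroup X →* FreeGroup X := MonoidHom.mk' (fun h => relHom x₀ (θ₀ h)) fun a b => by
    rw [← _root_.map_mul]
    apply hE
    rw [hθ₀, _root_.map_mul, _root_.map_mul, _root_.map_mul, hθ₀, hθ₀]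
  have hθE : ∀ h, E (θ h) = φ (E h) := fun h => by
    rw [← hθ₀]; exact hom_relHom hE1 _
  have hrel : ∀ h, relHom x₀ (θ h) = θ h := fun h => relHom_relHom _ _
  have hmap : ∀ h, E (map c (relHom x₀ h)) = α (E h) := fun h => by
    have : (E.comp (map c)).comp (relHom x₀) = α.comp E :=
      ext_hom _ _ fun x => by simp [← hEα]
    exact DFunLike.congr_fun this h
  have hθ1 : θ (of x₀) = 1 := by
    have := hE (θ₀ (of x₀)) 1 (by rw [hθ₀, hE1, _root_.map_one, _root_.map_one])
    rw [_root_.map_one] at this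
    exact this
  obtain ⟨w₀, hw₀⟩ := hsurj (of x₀ * (of (c x₀))⁻¹)
  obtain ⟨s, hs⟩ := exists_eq_map_pow_of_equivariant (θ := θ) hN hc htrans hθ1 (fun i j => by
      have e := hE (θ (of (c i) * (of (c j))⁻¹)) (map c (relHom x₀ (θ (of i * (of j)⁻¹)))) (by
        rw [hθE, hmap, hθE, ← hφα, ← hmap]
        congr 2
        simp)
      rw [relHom_map_relHom, hrel, hrel] at e
      exact e) (w₀ := w₀) (by
        have := hE (θ w₀) (of x₀ * (of (c x₀))⁻¹) (by rw [hθE, hw₀])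
        rw [hrel] at this
        rw [this]; simp) hx₀
  have hpow : ∀ (s : ℕ) h, E (map (c ^ s : Equiv.Perm X) (relHom x₀ h)) = α^[s] (E h) := by
    intro s h
    induction s with
    | zero => simpa using hom_relHom hE1 h
    | succ s ih =>
      rw [Function.iterate_succ_apply', ← ih, ← hmap, relHom_map_relHom, pow_succ', map_perm_mul]
  exact ⟨s, fun h => by rw [← hθE, hs, hpow]⟩

end FreeGroup

namespace AutFree

open FreeGroup PointedGraph

variable {p : ℕ}

/-! ### The edge group of two Θ-graphs as a free group -/

/-- The letter of the free group on the unoriented edges that corresponds to an oriented edge. -/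
def edgeLetter (e : Bool × Fin p × Bool) : (Bool × Fin p) × Bool := ((e.1, e.2.1), !e.2.2)

theorem edgeLetter_injective : Function.Injective (edgeLetter (p := p)) := by
  rintro ⟨s, i, o⟩ ⟨s', i', o'⟩ h
  simp only [edgeLetter, Prod.mk.injEq, Bool.not_inj_iff] at h ⊢
  tauto

/-- The edge group of two Θ-graphs is the free group on the edges. -/
def toFree (p : ℕ) (b : Vertex) : (doubleTheta p b).EdgeGroup →* FreeGroup (Bool × Fin p) :=
  PresentedGroup.toGroup (f := fun e => FreeGroup.mk [edgeLetter e]) (by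
    rintro _ ⟨⟨s, i, o⟩, rfl⟩
    rw [_root_.map_mul, lift_apply_of, lift_apply_of, edgeLetter, edgeLetter, mul_mk]
    refine (Quot.sound ?_ : FreeGroup.mk _ = FreeGroup.mk [])
    exact Red.Step.not (L₁ := []) (L₂ := []) (x := (s, i)) (b := !o))

theorem toFree_edge (b : Vertex) (e : Bool × Fin p × Bool) :
    toFree p b ((doubleTheta p b).edge e) = FreeGroup.mk [edgeLetter e] :=
  PresentedGroup.toGroup.of _

theorem toFree_word (b : Vertex) (l : List (Bool × Fin p × Bool)) :
    toFree p b ((doubleTheta p b).word l) = FreeGroup.mk (l.map edgeLetter) := by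
  induction l with
  | nil => simp [word, one_eq_mk]
  | cons e l ih =>
    have : (doubleTheta p b).word (e :: l) =
        (doubleTheta p b).edge e * (doubleTheta p b).word l := by simp [word]
    rw [this, _root_.map_mul, ih, toFree_edge, mul_mk]; rfl

/-- The inverse of `toFree`. -/
def ofFree (p : ℕ) (b : Vertex) : FreeGroup (Bool × Fin p) →* (doubleTheta p b).EdgeGroup :=
  lift fun q => (doubleTheta p b).edge (q.1, q.2, false)

theorem toFree_ofFree (b : Vertex) (w : FreeGroup (Bool × Fin p)) :
    toFree p b (ofFree p b w) = w := by
  have : (toFree p b).comp (ofFree p b) = MonoidHom.id _ :=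
    ext_hom _ _ fun q => by
      simp only [ofFree, MonoidHom.comp_apply, lift_apply_of, toFree_edge]; rfl
  exact DFunLike.congr_fun this w

theorem ofFree_toFree (b : Vertex) (g : (doubleTheta p b).EdgeGroup) :
    ofFree p b (toFree p b g) = g := by
  have : (ofFree p b).comp (toFree p b) = MonoidHom.id _ := PresentedGroup.ext fun e => by
    change ofFree p b (toFree p b ((doubleTheta p b).edge e)) = (doubleTheta p b).edge e
    rw [toFree_edge]
    obtain ⟨s, i, o⟩ := e
    cases o with
    | false => exact lift_apply_of
    | true =>
      have e : (FreeGroup.mk [edgeLetter (s, i, true)]) = (of (s, i))⁻¹ := by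
        simp [edgeLetter, of, inv_mk, invRev]
      rw [e, _root_.map_inv, ofFree, lift_apply_of, ← edge_rev]
      rfl
  exact DFunLike.congr_fun this g

theorem toFree_injective (b : Vertex) : Function.Injective (toFree p b) :=
  Function.LeftInverse.injective (ofFree_toFree b)

/-- The set of classes of edge paths from `v` to `w`. -/
def IsPathClass (b v w : Vertex) (g : FreeGroup (Bool × Fin p)) : Prop :=
  ∃ l, (doubleTheta p b).IsPath v w l ∧ (doubleTheta p b).word l = ofFree p b g

theorem IsPathClass.mul {b u v w : Vertex} {g h : FreeGroup (Bool × Fin p)}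
    (hg : IsPathClass b u v g) (hh : IsPathClass b v w h) : IsPathClass b u w (g * h) := by
  obtain ⟨l, hl, hl'⟩ := hg
  obtain ⟨m, hm, hm'⟩ := hh
  exact ⟨l ++ m, hl.append hm, by rw [word_append, hl', hm', _root_.map_mul]⟩

theorem IsPathClass.inv {b v w : Vertex} {g : FreeGroup (Bool × Fin p)}
    (hg : IsPathClass b v w g) : IsPathClass b w v g⁻¹ := by
  obtain ⟨l, hl, hl'⟩ := hg
  exact ⟨_, hl.reverse, by rw [word_reverse, hl', _root_.map_inv]⟩

theorem isPathClass_of (b : Vertex) (q : Bool × Fin p) :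
    IsPathClass b .mid (.tip q.1) (of q) := by
  refine ⟨[(q.1, q.2, false)], ?_, by simp [word, ofFree]⟩
  exact IsPath.cons (Γ := doubleTheta p b) (q.1, q.2, false) (IsPath.nil _)

/-- A closed edge path as an element of the free group on the edges. -/
def loopWord (p : ℕ) (b : Vertex) : (doubleTheta p b).pi1 →* FreeGroup (Bool × Fin p) :=
  (toFree p b).comp (doubleTheta p b).pi1.subtype

theorem loopWord_injective (b : Vertex) : Function.Injective (loopWord p b) :=
  (toFree_injective b).comp Subtype.val_injective

/-! ### Collapsing the spanning tree -/

section Tree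

variable [NeZero p]

/-- The path in the spanning tree that consists of the edges number `0`, from `mid`. -/
def treePath : Vertex → FreeGroup (Bool × Fin p)
  | .mid => 1
  | .tip s => of (s, 0)

/-- The projection of the edge group onto the fundamental group that collapses the
spanning tree. -/
def collapse (p : ℕ) [NeZero p] (b : Vertex) :
    FreeGroup (Bool × Fin p) →* FreeGroup (Bool × Fin p) :=
  lift fun q => (treePath b)⁻¹ * (of q * (of (q.1, 0))⁻¹) * treePath b

@[simp] theorem collapse_of (b : Vertex) (q : Bool × Fin p) :
    collapse p b (of q) = (treePath b)⁻¹ * (of q * (of (q.1, 0))⁻¹) * treePath b :=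
  lift_apply_of

/-- Each edge is replaced by itself closed up along the tree, and the tree paths telescope along an
edge path. For a closed path at `b` everything cancels, so `collapse` is a retraction onto the
loops. -/
theorem collapse_word (b : Vertex) {v w : Vertex} {l : List (Bool × Fin p × Bool)}
    (hl : (doubleTheta p b).IsPath v w l) :
    collapse p b (toFree p b ((doubleTheta p b).word l)) =
      (treePath b)⁻¹ * (treePath v * toFree p b ((doubleTheta p b).word l) *
        (treePath w)⁻¹) * treePath b := by
  refine IsPath.rec (Γ := doubleTheta p b) (motive := fun v w l _ =>
    collapse p b (toFree p b ((doubleTheta p b).word l)) =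
      (treePath b)⁻¹ * (treePath v * toFree p b ((doubleTheta p b).word l) *
        (treePath w)⁻¹) * treePath b) ?_ ?_ hl
  · intro v
    simp [word]
  · intro e w l _ ih
    have h1 : (doubleTheta p b).word (e :: l) =
        (doubleTheta p b).edge e * (doubleTheta p b).word l := by simp [word]
    rw [h1, _root_.map_mul, _root_.map_mul, ih]
    have h2 : collapse p b (toFree p b ((doubleTheta p b).edge e)) =
        (treePath b)⁻¹ * (treePath ((doubleTheta p b).init e) *
          toFree p b ((doubleTheta p b).edge e) *
          (treePath ((doubleTheta p b).term e))⁻¹) * treePath b := by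
      obtain ⟨s, i, o⟩ := e
      rw [toFree_edge]
      cases o with
      | false =>
        have e : (FreeGroup.mk [edgeLetter (s, i, false)]) = of (s, i) := rfl
        simp [e, term, treePath, mul_assoc]
      | true =>
        have e : (FreeGroup.mk [edgeLetter (s, i, true)]) = (of (s, i))⁻¹ := by
          simp [edgeLetter, of, inv_mk, invRev]
        simp [e, term, treePath, mul_assoc]
    rw [h2]
    group

theorem isPathClass_treePath (b v : Vertex) : IsPathClass (p := p) b .mid v (treePath v) := by
  cases v with
  | mid => exact ⟨[], IsPath.nil _, by simp [word, treePath]⟩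
  | tip s => exact isPathClass_of b (s, 0)

theorem ofFree_collapse_mem (b : Vertex) (w : FreeGroup (Bool × Fin p)) :
    ofFree p b (collapse p b w) ∈ (doubleTheta p b).pi1 := by
  suffices h : (⊤ : Subgroup (FreeGroup (Bool × Fin p))) ≤
      (doubleTheta p b).pi1.comap ((ofFree p b).comp (collapse p b)) from
    h (Subgroup.mem_top w)
  rw [← FreeGroup.closure_range_of, Subgroup.closure_le]
  rintro _ ⟨q, rfl⟩
  change ofFree p b (collapse p b (of q)) ∈ (doubleTheta p b).pi1
  rw [collapse_of]
  exact ((isPathClass_treePath b b).inv.mul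
    ((isPathClass_of b q).mul (isPathClass_of b (q.1, 0)).inv)).mul (isPathClass_treePath b b)

/-- The loop that is obtained from a word by collapsing the spanning tree. -/
def toLoop (p : ℕ) [NeZero p] (b : Vertex) :
    FreeGroup (Bool × Fin p) →* (doubleTheta p b).pi1 :=
  ((ofFree p b).comp (collapse p b)).codRestrict _ (ofFree_collapse_mem b)

theorem loopWord_toLoop (b : Vertex) (w : FreeGroup (Bool × Fin p)) :
    loopWord p b (toLoop p b w) = collapse p b w :=
  toFree_ofFree b _

theorem collapse_loopWord (b : Vertex) (g : (doubleTheta p b).pi1) :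
    collapse p b (loopWord p b g) = loopWord p b g := by
  obtain ⟨_, l, hl, rfl⟩ := g
  refine (collapse_word b hl).trans ?_
  change _ = toFree p b ((doubleTheta p b).word l)
  group

theorem toLoop_loopWord (b : Vertex) (g : (doubleTheta p b).pi1) :
    toLoop p b (loopWord p b g) = g :=
  loopWord_injective b (by rw [loopWord_toLoop, collapse_loopWord])

theorem toLoop_of_zero (b : Vertex) (s : Bool) : toLoop p b (of (s, 0)) = 1 :=
  loopWord_injective b (by rw [loopWord_toLoop]; simp)

theorem mulAut_ext_of_toLoop {b : Vertex} {φ ψ : MulAut (doubleTheta p b).pi1}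
    (h : ∀ q, φ (toLoop p b (of q)) = ψ (toLoop p b (of q))) : φ = ψ := by
  have h1 : φ.toMonoidHom.comp (toLoop p b) = ψ.toMonoidHom.comp (toLoop p b) :=
    ext_hom _ _ h
  refine MulEquiv.ext fun g => ?_
  rw [← toLoop_loopWord b g]
  exact DFunLike.congr_fun h1 _

/-- The fundamental group of two Θ-graphs with `m + 1` edges each is free of rank `2m`. -/
theorem nonempty_marking (m : ℕ) (b : Vertex) :
    Nonempty ((doubleTheta (m + 1) b).Marking (2 * m)) := by
  -- The edges number `0` form the tree and are killed; the other `m` edges of each graph give the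
  -- basis.
  let ρ : FreeGroup (Bool × Fin (m + 1)) →* FreeGroup (Bool × Fin m) :=
    lift fun q => Fin.cases 1 (fun i => of (q.1, i)) q.2
  let f : FreeGroup (Bool × Fin m) →* (doubleTheta (m + 1) b).pi1 :=
    (toLoop (m + 1) b).comp (map fun q => (q.1, q.2.succ))
  have hρ0 : ∀ s, ρ (of (s, 0)) = 1 := fun s => by simp [ρ]
  have hρb : ρ (treePath b) = 1 := by
    cases b with
    | mid => simp [treePath]
    | tip s => exact hρ0 s
  have h1 : ∀ w, ρ (loopWord (m + 1) b (f w)) = w := fun w => by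
    have : (ρ.comp (loopWord (m + 1) b)).comp f = MonoidHom.id _ := ext_hom _ _ fun q => by
      simp only [f, MonoidHom.comp_apply, map.of, loopWord_toLoop, collapse_of, _root_.map_mul,
        _root_.map_inv, hρb, hρ0]
      simp [ρ]
    exact DFunLike.congr_fun this w
  have h2 : ∀ g, f (ρ (loopWord (m + 1) b g)) = g := fun g => by
    have : f.comp ρ = toLoop (m + 1) b := ext_hom _ _ fun q => by
      obtain ⟨s, i⟩ := q
      refine Fin.cases ?_ (fun i => ?_) i
      · rw [MonoidHom.comp_apply, hρ0, toLoop_of_zero, _root_.map_one]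
      · simp [ρ, f]
    exact (DFunLike.congr_fun this _).trans (toLoop_loopWord b g)
  let e : FreeGroup (Bool × Fin m) ≃* (doubleTheta (m + 1) b).pi1 :=
    { f with
      invFun := fun g => ρ (loopWord (m + 1) b g)
      left_inv := h1
      right_inv := h2 }
  exact ⟨(freeGroupCongr (Fintype.equivOfCardEq (by simp))).trans e⟩

end Tree

/-! ### The action of the graph automorphisms -/

theorem isReduced_map_edgeLetter {l : List (Bool × Fin p × Bool)} {b : Vertex}
    (hl : l.IsChain fun e e' => e' ≠ (doubleTheta p b).rev e) :
    IsReduced (l.map edgeLetter) := by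
  refine (List.isChain_map _).2 (hl.imp ?_)
  rintro ⟨s, i, o⟩ ⟨s', i', o'⟩ h h'
  simp only [edgeLetter, Prod.mk.injEq] at h h' ⊢
  by_contra h''
  refine h ?_
  obtain ⟨rfl, rfl⟩ := h'
  cases o <;> cases o' <;> simp_all

/-- A graph automorphism maps a path without backtracking to another one, and two such paths with
the same class are equal edge by edge. Faithfulness follows because every edge lies on such a closed
path. -/
theorem edge_fixed_of_pi1Action_eq_one {b : Vertex} {σ : (doubleTheta p b).autGroup}
    (hσ : (doubleTheta p b).pi1Action σ = 1) {l : List (Bool × Fin p × Bool)}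
    (hl : (doubleTheta p b).IsPath b b l)
    (hl' : l.IsChain fun e e' => e' ≠ (doubleTheta p b).rev e) {e : Bool × Fin p × Bool}
    (he : e ∈ l) : σ.1.2 e = e := by
  have h1 : edgeMap σ ((doubleTheta p b).word l) = (doubleTheta p b).word l :=
    congrArg Subtype.val (DFunLike.congr_fun hσ
      (⟨(doubleTheta p b).word l, l, hl, rfl⟩ : (doubleTheta p b).pi1))
  rw [edgeMap_word] at h1
  have h2 := congrArg (toFree p b) h1
  rw [toFree_word, toFree_word] at h2
  have h3 := congrArg toWord h2
  rw [toWord_mk_of_isReduced, toWord_mk_of_isReduced (isReduced_map_edgeLetter hl')] at h3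
  · have h4 := List.map_injective_iff.2 edgeLetter_injective h3
    have h5 : List.map σ.1.2 l = List.map id l := by rw [List.map_id]; exact h4
    exact List.map_inj_left.1 h5 e he
  · refine isReduced_map_edgeLetter (b := b) ((List.isChain_map _).2 (hl'.imp ?_))
    intro e e' h h'
    exact h (σ.1.2.injective (h'.trans (σ.2.2.1 e)))

theorem autGroup_ext_edges [NeZero p] {b : Vertex} {σ τ : (doubleTheta p b).autGroup}
    (h : ∀ s i, σ.1.2 (s, i, false) = τ.1.2 (s, i, false)) : σ = τ := by
  have h' : ∀ e, σ.1.2 e = τ.1.2 e := by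
    rintro ⟨s, i, o⟩
    cases o with
    | false => exact h s i
    | true =>
      have h1 := σ.2.2.1 (s, i, false)
      have h2 := τ.2.2.1 (s, i, false)
      rw [h] at h1
      exact h1.symm.trans h2
  refine Subtype.ext (Prod.ext (Equiv.ext fun v => ?_) (Equiv.ext h'))
  obtain ⟨e, rfl⟩ : ∃ e, (doubleTheta p b).init e = v := by
    cases v with
    | mid => exact ⟨(false, 0, false), rfl⟩
    | tip s => exact ⟨(s, 0, true), rfl⟩
  exact (σ.2.1 e).symm.trans ((congrArg _ (h' e)).trans (τ.2.1 e))

theorem isPath_cons' {b v w : Vertex} {e : Bool × Fin p × Bool} {l : List (Bool × Fin p × Bool)}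
    (hv : (doubleTheta p b).init e = v) (hl : (doubleTheta p b).IsPath
      ((doubleTheta p b).term e) w l) : (doubleTheta p b).IsPath v w (e :: l) :=
  hv ▸ IsPath.cons (Γ := doubleTheta p b) e hl

theorem pi1Action_injective_Psi [NeZero p] (hp : 2 ≤ p) :
    Function.Injective (Psi p).pi1Action := by
  rw [injective_iff_map_eq_one]
  intro σ hσ
  refine autGroup_ext_edges fun s i => ?_
  have : Nontrivial (Fin p) := Fin.nontrivial_iff_two_le.2 hp
  obtain ⟨j, hj⟩ := exists_ne i
  refine edge_fixed_of_pi1Action_eq_one hσ (l := [(s, i, false), (s, j, true)]) ?_ ?_ (by simp)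
  · exact isPath_cons' rfl (isPath_cons' rfl (IsPath.nil _))
  · simp [hj]

theorem pi1Action_injective_Omega [NeZero p] (hp : 2 ≤ p) :
    Function.Injective (Omega p).pi1Action := by
  rw [injective_iff_map_eq_one]
  intro σ hσ
  refine autGroup_ext_edges fun s i => ?_
  have : Nontrivial (Fin p) := Fin.nontrivial_iff_two_le.2 hp
  obtain ⟨j, hj⟩ := exists_ne i
  cases s with
  | false =>
    refine edge_fixed_of_pi1Action_eq_one hσ (l := [(false, j, true), (false, i, false)])
      ?_ ?_ (by simp)
    · exact isPath_cons' rfl (isPath_cons' rfl (IsPath.nil _))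
    · simp [hj.symm]
  | true =>
    -- Edges of the far graph are reached through edge number `0` of the near graph; the turn at the
    -- far vertex is from `i` to `j ≠ i`.
    refine edge_fixed_of_pi1Action_eq_one hσ (l := [(false, 0, true), (true, i, false),
      (true, j, true), (false, 0, false)]) ?_ ?_ (by simp)
    · exact isPath_cons' rfl (isPath_cons' rfl (isPath_cons' rfl (isPath_cons' rfl
        (IsPath.nil _))))
    · simp [hj]

/-- The permutation of the unoriented edges induced by permutations of the two sets of edges. -/
def edgePerm (σ : Equiv.Perm (Fin p) × Equiv.Perm (Fin p)) : Equiv.Perm (Bool × Fin p) where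
  toFun q := (q.1, (if q.1 then σ.2 else σ.1) q.2)
  invFun q := (q.1, (if q.1 then σ.2 else σ.1)⁻¹ q.2)
  left_inv q := by simp
  right_inv q := by simp

@[simp] theorem edgePerm_false (σ : Equiv.Perm (Fin p) × Equiv.Perm (Fin p)) (i : Fin p) :
    edgePerm σ (false, i) = (false, σ.1 i) := rfl

@[simp] theorem edgePerm_true (σ : Equiv.Perm (Fin p) × Equiv.Perm (Fin p)) (i : Fin p) :
    edgePerm σ (true, i) = (true, σ.2 i) := rfl

/-- The action of `Σ_p × Σ_p` on the fundamental group. -/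
def permAction (p : ℕ) (b : Vertex) :
    Equiv.Perm (Fin p) × Equiv.Perm (Fin p) →* MulAut (doubleTheta p b).pi1 :=
  (doubleTheta p b).pi1Action.comp (permuteEdges p b)

theorem loopWord_permAction (b : Vertex) (σ : Equiv.Perm (Fin p) × Equiv.Perm (Fin p))
    (g : (doubleTheta p b).pi1) :
    loopWord p b (permAction p b σ g) = map (edgePerm σ) (loopWord p b g) := by
  obtain ⟨_, l, hl, rfl⟩ := g
  change toFree p b (edgeMap (permuteEdges p b σ) ((doubleTheta p b).word l)) =
    map (edgePerm σ) (toFree p b ((doubleTheta p b).word l))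
  rw [edgeMap_word, toFree_word, toFree_word, map_mk_eq, mapWord, List.map_map, List.map_map]
  congr 1
  refine List.map_congr_left ?_
  rintro ⟨s, i, o⟩ -
  cases s <;> rfl

theorem eq_one_of_permAction_eq {b : Vertex} {σ : Equiv.Perm (Fin p) × Equiv.Perm (Fin p)}
    (h1 : ∀ i, σ.1 i ≠ i) (h2 : ∀ i, σ.2 i ≠ i) {g : (doubleTheta p b).pi1}
    (hg : permAction p b σ g = g) : g = 1 := by
  refine (map_eq_one_iff _ (loopWord_injective b)).1 (eq_one_of_map_eq (c := edgePerm σ) ?_ ?_)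
  · rintro ⟨_ | _, i⟩
    · simpa using h1 i
    · simpa using h2 i
  · rw [← loopWord_permAction, hg]

/-- If the edges of the graph other than `s` are all moved, the letters of a fixed word can only
belong to the graph `s`. -/
theorem mem_range_map_of_map_edgePerm_eq {σ : Equiv.Perm (Fin p) × Equiv.Perm (Fin p)}
    (s : Bool) (h : ∀ i, (if s then σ.1 else σ.2) i ≠ i) {w : FreeGroup (Bool × Fin p)}
    (hw : map (edgePerm σ) w = w) : ∃ h, map (Prod.mk s) h = w := by
  classical
  refine mem_range_map_of_toWord fun x hx => ?_
  have h1 := letter_fixed_of_map_eq hw hx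
  obtain ⟨⟨s', i⟩, o⟩ := x
  have : s' = s := by
    by_contra hs
    cases s <;> cases s' <;> simp_all
  exact ⟨i, by rw [this]⟩

end AutFree

namespace AutFree

open FreeGroup PointedGraph

variable {p : ℕ}

/-! ### The rotation of the edges -/

theorem finRotate_apply_ne (hp : 2 ≤ p) (i : Fin p) : finRotate p i ≠ i :=
  Equiv.Perm.mem_support.1 (by rw [support_finRotate_of_le hp]; exact Finset.mem_univ i)

theorem finRotate_ne_one (hp : 2 ≤ p) : finRotate p ≠ 1 := fun h =>
  finRotate_apply_ne hp ⟨0, by omega⟩ (by rw [h]; rfl)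

theorem exists_finRotate_pow_eq (hp : 2 ≤ p) (i j : Fin p) : ∃ n : ℕ, (finRotate p ^ n) i = j :=
  (isCycle_finRotate_of_le hp).exists_pow_eq (finRotate_apply_ne hp i) (finRotate_apply_ne hp j)

theorem eq_one_of_commute_finRotate (hp : 2 ≤ p) {d : Equiv.Perm (Fin p)}
    (hd : Commute d (finRotate p)) {i : Fin p} (hi : d i = i) : d = 1 := by
  refine Equiv.ext fun j => ?_
  obtain ⟨n, rfl⟩ := exists_finRotate_pow_eq hp i j
  rw [← Equiv.Perm.mul_apply, (hd.pow_right n).eq, Equiv.Perm.mul_apply, hi]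
  rfl

theorem commute_of_mem_cyclicSubgroup {d e : Equiv.Perm (Fin p)} (hd : d ∈ cyclicSubgroup p)
    (he : e ∈ cyclicSubgroup p) : Commute d e := by
  obtain ⟨m, rfl⟩ := Subgroup.mem_zpowers_iff.1 hd
  obtain ⟨n, rfl⟩ := Subgroup.mem_zpowers_iff.1 he
  exact Commute.zpow_zpow_self _ _ _

theorem finRotate_mem : finRotate p ∈ cyclicSubgroup p := Subgroup.mem_zpowers _

theorem apply_ne_of_mem_cyclicSubgroup (hp : 2 ≤ p) {d : Equiv.Perm (Fin p)}
    (hd : d ∈ cyclicSubgroup p) (h1 : d ≠ 1) (i : Fin p) : d i ≠ i := fun hi =>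
  h1 (eq_one_of_commute_finRotate hp (commute_of_mem_cyclicSubgroup hd finRotate_mem) hi)

/-- Since `p` is prime, a nontrivial power of the `p`-cycle is again a `p`-cycle, and cycles of
equal length are conjugate. -/
theorem exists_conj_finRotate (hp : p.Prime) {d : Equiv.Perm (Fin p)}
    (hd : d ∈ cyclicSubgroup p) (h1 : d ≠ 1) : ∃ σ : Equiv.Perm (Fin p), d * σ = σ * finRotate p := by
  have hc := isCycle_finRotate_of_le hp.two_le
  have hsupp : d.support = Finset.univ := Finset.eq_univ_iff_forall.2 fun i =>
    Equiv.Perm.mem_support.2 (apply_ne_of_mem_cyclicSubgroup hp.two_le hd h1 i)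
  have hord : orderOf (finRotate p) = p := by
    rw [hc.orderOf, support_finRotate_of_le hp.two_le, Finset.card_univ, Fintype.card_fin]
  obtain ⟨n, rfl⟩ := (Submonoid.mem_powers_iff _ _).1
    ((mem_powers_iff_mem_zpowers (x := finRotate p)).2 hd)
  have hdc : (finRotate p ^ n).IsCycle := by
    have hmod : finRotate p ^ n = finRotate p ^ (n % p) := by
      conv_lhs => rw [← pow_mod_orderOf, hord]
    rw [hmod] at h1 ⊢
    refine hc.isCycle_pow_pos_of_lt_prime_order (by rwa [hord]) _
      (Nat.pos_of_ne_zero fun h => h1 (by rw [h, pow_zero])) ?_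
    rw [hord]
    exact Nat.mod_lt _ hp.pos
  obtain ⟨σ, hσ⟩ := isConj_iff.1 (hc.isConj hdc (by rw [hsupp, support_finRotate_of_le hp.two_le]))
  exact ⟨σ, by rw [← hσ]; group⟩

theorem permuteEdges_injective (b : Vertex) : Function.Injective (permuteEdges p b) := by
  intro σ τ h
  have h' : ∀ e : Bool × Fin p × Bool, (permuteEdges p b σ).1.2 e = (permuteEdges p b τ).1.2 e :=
    fun e => by rw [h]
  refine Prod.ext (Equiv.ext fun i => ?_) (Equiv.ext fun i => ?_)
  · exact congrArg (fun e => e.2.1) (h' (false, i, false))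
  · exact congrArg (fun e => e.2.1) (h' (true, i, false))

theorem iterate_permAction (b : Vertex) (σ : Equiv.Perm (Fin p) × Equiv.Perm (Fin p)) (n : ℕ)
    (g : (doubleTheta p b).pi1) :
    (permAction p b σ).toMonoidHom^[n] g = permAction p b (σ ^ n) g := by
  induction n with
  | zero => simp
  | succ n ih =>
    rw [Function.iterate_succ_apply', ih, pow_succ', _root_.map_mul]; rfl

theorem permAction_mul_apply (b : Vertex) (σ τ : Equiv.Perm (Fin p) × Equiv.Perm (Fin p))
    (g : (doubleTheta p b).pi1) :
    permAction p b (σ * τ) g = permAction p b σ (permAction p b τ g) := by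
  rw [_root_.map_mul]; rfl

theorem map_rotations (b : Vertex) :
    (rotations p b).map (doubleTheta p b).pi1Action =
      ((cyclicSubgroup p).prod (cyclicSubgroup p)).map (permAction p b) := by
  rw [rotations, Subgroup.map_map]; rfl

theorem exists_conj_permAction {b : Vertex} {φ : MulAut (doubleTheta p b).pi1}
    (hφ : φ ∈ Subgroup.normalizer
      ((rotations p b).map (doubleTheta p b).pi1Action : Set (MulAut (doubleTheta p b).pi1)))
    {σ : Equiv.Perm (Fin p) × Equiv.Perm (Fin p)} (h1 : σ.1 ∈ cyclicSubgroup p)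
    (h2 : σ.2 ∈ cyclicSubgroup p) :
    ∃ d ∈ cyclicSubgroup p, ∃ e ∈ cyclicSubgroup p,
      ∀ g, φ (permAction p b σ g) = permAction p b (d, e) (φ g) := by
  rw [map_rotations] at hφ
  obtain ⟨τ, hτ, h⟩ := (Subgroup.mem_normalizer_iff.1 hφ (permAction p b σ)).1 ⟨σ, ⟨h1, h2⟩, rfl⟩
  refine ⟨τ.1, hτ.1, τ.2, hτ.2, fun g => ?_⟩
  change _ = permAction p b τ (φ g)
  rw [h]
  simp

theorem mul_permAction_mem_range {b : Vertex} {φ : MulAut (doubleTheta p b).pi1}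
    (σ : Equiv.Perm (Fin p) × Equiv.Perm (Fin p))
    (h : (permAction p b σ)⁻¹ * φ ∈ (doubleTheta p b).pi1Action.range) :
    φ ∈ (doubleTheta p b).pi1Action.range := by
  have := mul_mem (show permAction p b σ ∈ (doubleTheta p b).pi1Action.range from ⟨_, rfl⟩) h
  rwa [mul_inv_cancel_left] at this

/-- Correcting `φ` by the graph automorphism `ρ` replaces the target `τ` by `ρ⁻¹ τ ρ`; this
normalizes `φ` until it commutes with rotations. -/
theorem conj_inv_mul_apply {b : Vertex} {φ : MulAut (doubleTheta p b).pi1}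
    {σ τ ρ ρ' : Equiv.Perm (Fin p) × Equiv.Perm (Fin p)} (hρ : τ * ρ = ρ * ρ')
    (h : ∀ g, φ (permAction p b σ g) = permAction p b τ (φ g)) (g : (doubleTheta p b).pi1) :
    ((permAction p b ρ)⁻¹ * φ) (permAction p b σ g) =
      permAction p b ρ' (((permAction p b ρ)⁻¹ * φ) g) := by
  rw [MulAut.mul_apply, MulAut.mul_apply, h, ← _root_.map_inv, ← permAction_mul_apply,
    ← permAction_mul_apply]
  congr 2
  rw [inv_mul_eq_iff_eq_mul, ← mul_assoc, ← hρ]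
  group

theorem map_edgePerm_mk (s : Bool) (σ : Equiv.Perm (Fin p) × Equiv.Perm (Fin p))
    (h : FreeGroup (Fin p)) :
    map (edgePerm σ) (map (Prod.mk s) h) =
      map (Prod.mk s) (map (if s then σ.2 else σ.1 : Equiv.Perm (Fin p)) h) := by
  rw [map.comp, map.comp]
  cases s <;> rfl

theorem map_one_perm {X : Type*} (w : FreeGroup X) : map (1 : Equiv.Perm X) w = w :=
  map.id w

/-! ### The basepoint `mid` -/

section Psi

variable [NeZero p]

theorem collapse_mid (s : Bool) (h : FreeGroup (Fin p)) :
    collapse p .mid (map (Prod.mk s) h) = map (Prod.mk s) (relHom 0 h) := by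
  have : (collapse p .mid).comp (map (Prod.mk s)) = (map (Prod.mk s)).comp (relHom 0) :=
    ext_hom _ _ fun i => by simp [treePath]
  exact DFunLike.congr_fun this h

/-- The loops in one of the two Θ-graphs, joined to the basepoint along the spanning tree. -/
def petalLoop (p : ℕ) [NeZero p] (b : Vertex) (s : Bool) :
    FreeGroup (Fin p) →* (doubleTheta p b).pi1 :=
  (toLoop p b).comp (map (Prod.mk s))

theorem loopWord_petalLoop_mid (s : Bool) (h : FreeGroup (Fin p)) :
    loopWord p .mid (petalLoop p .mid s h) = map (Prod.mk s) (relHom 0 h) :=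
  (loopWord_toLoop _ _).trans (collapse_mid s h)

theorem petalLoop_of_zero (b : Vertex) (s : Bool) : petalLoop p b s (of 0) = 1 :=
  toLoop_of_zero b s

theorem relHom_of_ne_one {i : Fin p} (hi : i ≠ 0) : relHom 0 (of i) ≠ 1 := by
  rw [relHom_of, Ne, mul_inv_eq_one]
  exact fun h => hi (of_injective h)

theorem exists_petalLoop_eq_mid (s : Bool) {σ : Equiv.Perm (Fin p) × Equiv.Perm (Fin p)}
    (h : ∀ i, (if s then σ.1 else σ.2) i ≠ i) {g : (Psi p).pi1}
    (hg : permAction p .mid σ g = g) : ∃ h, petalLoop p .mid s h = g := by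
  obtain ⟨k, hk⟩ := mem_range_map_of_map_edgePerm_eq (w := loopWord p .mid g) s h
    (by rw [← loopWord_permAction, hg])
  exact ⟨k, by rw [← toLoop_loopWord .mid g, ← hk]; rfl⟩

theorem permAction_petalLoop_mid (s : Bool) {σ : Equiv.Perm (Fin p) × Equiv.Perm (Fin p)}
    (hσ : (if s then σ.2 else σ.1) = 1) (h : FreeGroup (Fin p)) :
    permAction p .mid σ (petalLoop p .mid s h) = petalLoop p .mid s h := by
  apply loopWord_injective
  rw [loopWord_permAction, loopWord_petalLoop_mid, map_edgePerm_mk, hσ, map_one_perm]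

theorem petalLoop_mid_of_ne_one (s : Bool) {i : Fin p} (hi : i ≠ 0) :
    petalLoop p .mid s (of i) ≠ 1 := fun h => by
  have h1 := loopWord_petalLoop_mid s (of i)
  rw [h, _root_.map_one] at h1
  exact relHom_of_ne_one hi ((map_eq_one_iff _ (map_injective (Prod.mk_right_injective s))).1 h1.symm)

/-- The rotation of one of the two Θ-graphs. -/
def rotateOne (p : ℕ) (s : Bool) : Equiv.Perm (Fin p) × Equiv.Perm (Fin p) :=
  if s then (1, finRotate p) else (finRotate p, 1)

/-- Commuting with the rotation of the other graph, `φ` preserves its fixed subgroup, the loops in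
the graph `s`; rigidity applies there. -/
theorem exists_eq_rotateOne_pow_mid (hp : 2 ≤ p) {φ : MulAut (Psi p).pi1}
    (hφ : ∀ s g, φ (permAction p .mid (rotateOne p s) g) =
      permAction p .mid (rotateOne p s) (φ g)) (s : Bool) :
    ∃ n : ℕ, ∀ h, φ (petalLoop p .mid s h) =
      permAction p .mid (rotateOne p s ^ n) (petalLoop p .mid s h) := by
  have hfix : ∀ ψ : MulAut (Psi p).pi1, (∀ g, ψ (permAction p .mid (rotateOne p !s) g) =
      permAction p .mid (rotateOne p !s) (ψ g)) →
      ∀ h, ∃ h', petalLoop p .mid s h' = ψ (petalLoop p .mid s h) := by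
    intro ψ hψ h
    refine exists_petalLoop_eq_mid s (σ := rotateOne p !s) ?_ ?_
    · intro i
      cases s <;> exact finRotate_apply_ne hp i
    · rw [← hψ, permAction_petalLoop_mid]
      cases s <;> rfl
  obtain ⟨n, hn⟩ := exists_apply_eq_iterate_of_commute (c := finRotate p) (orderOf_pos _)
    (pow_orderOf_eq_one _) (exists_finRotate_pow_eq hp) (x₀ := 0) (finRotate_apply_ne hp 0)
    (E := petalLoop p .mid s) (petalLoop_of_zero _ s) (φ := φ.toMonoidHom)
    (α := (permAction p .mid (rotateOne p s)).toMonoidHom)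
    (fun h h' hh => by
      have := congrArg (loopWord p .mid) hh
      rw [loopWord_petalLoop_mid, loopWord_petalLoop_mid] at this
      exact map_injective (Prod.mk_right_injective s) this)
    (fun i => by
      apply loopWord_injective
      change _ = loopWord p .mid (permAction p .mid (rotateOne p s) (petalLoop p .mid s (of i)))
      rw [loopWord_permAction, loopWord_petalLoop_mid, loopWord_petalLoop_mid, map_edgePerm_mk]
      cases s <;> simp [rotateOne])
    (fun h => hφ s _) (hfix φ (hφ _))
    -- Surjectivity on the petal: `φ⁻¹` satisfies the same commutation relations, so it preserves
    -- the petal too.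
    (fun h => by
      obtain ⟨h', hh'⟩ := hfix φ⁻¹ (fun g => by
        apply φ.injective
        rw [hφ]
        simp) h
      refine ⟨h', ?_⟩
      rw [hh']
      exact φ.apply_symm_apply _)
  exact ⟨n, fun h => (hn h).trans (iterate_permAction _ _ _ _)⟩

theorem mem_range_of_commute_mid (hp : 2 ≤ p) {φ : MulAut (Psi p).pi1}
    (hφ : ∀ s g, φ (permAction p .mid (rotateOne p s) g) =
      permAction p .mid (rotateOne p s) (φ g)) : φ ∈ (Psi p).pi1Action.range := by
  obtain ⟨m, hm⟩ := exists_eq_rotateOne_pow_mid hp hφ false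
  obtain ⟨n, hn⟩ := exists_eq_rotateOne_pow_mid hp hφ true
  refine ⟨permuteEdges p .mid (finRotate p ^ m, finRotate p ^ n), ?_⟩
  change permAction p .mid (finRotate p ^ m, finRotate p ^ n) = φ
  refine mulAut_ext_of_toLoop ?_
  rintro ⟨_ | _, i⟩
  · have e : ((finRotate p ^ m, finRotate p ^ n) : Equiv.Perm (Fin p) × Equiv.Perm (Fin p)) =
        rotateOne p false ^ m * (1, finRotate p ^ n) := by simp [rotateOne]
    rw [e, permAction_mul_apply]
    refine Eq.trans (congrArg _ ?_) (hm (of i)).symm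
    exact permAction_petalLoop_mid false (σ := (1, finRotate p ^ n)) rfl (of i)
  · have e : ((finRotate p ^ m, finRotate p ^ n) : Equiv.Perm (Fin p) × Equiv.Perm (Fin p)) =
        rotateOne p true ^ n * (finRotate p ^ m, 1) := by simp [rotateOne]
    rw [e, permAction_mul_apply]
    refine Eq.trans (congrArg _ ?_) (hn (of i)).symm
    exact permAction_petalLoop_mid true (σ := (finRotate p ^ m, 1)) rfl (of i)

theorem mem_range_of_conj_mid (hp : p.Prime) {φ : MulAut (Psi p).pi1} {d e : Equiv.Perm (Fin p)}
    (hd : d ∈ cyclicSubgroup p) (hd1 : d ≠ 1) (he : e ∈ cyclicSubgroup p) (he1 : e ≠ 1)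
    (h1 : ∀ g, φ (permAction p .mid (finRotate p, 1) g) = permAction p .mid (d, 1) (φ g))
    (h2 : ∀ g, φ (permAction p .mid (1, finRotate p) g) = permAction p .mid (1, e) (φ g)) :
    φ ∈ (Psi p).pi1Action.range := by
  obtain ⟨σ, hσ⟩ := exists_conj_finRotate hp hd hd1
  obtain ⟨τ, hτ⟩ := exists_conj_finRotate hp he he1
  refine mul_permAction_mem_range (σ, τ) (mem_range_of_commute_mid hp.two_le ?_)
  rintro (_ | _)
  · exact conj_inv_mul_apply (Prod.ext hσ (by simp [rotateOne])) h1
  · exact conj_inv_mul_apply (Prod.ext (by simp [rotateOne]) hτ) h2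

end Psi

/-! ### The exchange of the two Θ-graphs and the normalizer at `mid` -/

/-- The graph automorphism that exchanges the two Θ-graphs. -/
def swapGraph (p : ℕ) : (Psi p).autGroup :=
  ⟨(⟨fun | .mid => .mid | .tip s => .tip !s, fun | .mid => .mid | .tip s => .tip !s,
      by rintro (_ | s) <;> simp, by rintro (_ | s) <;> simp⟩,
    ⟨fun e : Bool × Fin p × Bool => (!e.1, e.2), fun e : Bool × Fin p × Bool => (!e.1, e.2),
      fun e => by simp, fun e => by simp⟩),
    by rintro ⟨s, i, _ | _⟩ <;> rfl, fun e => rfl, rfl⟩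

theorem swapGraph_mul_permuteEdges (σ τ : Equiv.Perm (Fin p)) :
    swapGraph p * permuteEdges p .mid (σ, τ) = permuteEdges p .mid (τ, σ) * swapGraph p := by
  refine Subtype.ext (Prod.ext rfl (Equiv.ext ?_))
  rintro ⟨_ | _, i, o⟩ <;> rfl

theorem swapGraph_mul_self : swapGraph p * swapGraph p = 1 := by
  refine Subtype.ext (Prod.ext (Equiv.ext ?_) (Equiv.ext ?_))
  · rintro (_ | _ | _) <;> rfl
  · rintro ⟨_ | _, i, o⟩ <;> rfl

theorem permAction_injective_mid [NeZero p] (hp : 2 ≤ p) :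
    Function.Injective (permAction p .mid) :=
  (pi1Action_injective_Psi hp).comp (permuteEdges_injective _)

theorem eq_one_of_conj_permAction {b : Vertex} (hinj : Function.Injective (permAction p b))
    {φ : MulAut (doubleTheta p b).pi1} {σ : Equiv.Perm (Fin p) × Equiv.Perm (Fin p)}
    (h : ∀ g, φ (permAction p b σ g) = permAction p b (1, 1) (φ g)) : σ = 1 := by
  apply hinj
  rw [_root_.map_one]
  refine MulEquiv.ext fun g => φ.injective ?_
  rw [h, Prod.mk_one_one, _root_.map_one]; rfl

theorem mem_range_of_mem_normalizer_mid (hp : p.Prime) {φ : MulAut (Psi p).pi1}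
    (hφ : φ ∈ Subgroup.normalizer
      ((rotations p .mid).map (Psi p).pi1Action : Set (MulAut (Psi p).pi1))) :
    φ ∈ (Psi p).pi1Action.range := by
  have : NeZero p := ⟨hp.ne_zero⟩
  have hp2 := hp.two_le
  have hc1 : finRotate p ≠ 1 := finRotate_ne_one hp2
  have hinj := permAction_injective_mid hp2
  have hmove := fun {d : Equiv.Perm (Fin p)} (hd : d ∈ cyclicSubgroup p) (h1 : d ≠ 1) =>
    apply_ne_of_mem_cyclicSubgroup hp2 hd h1
  have hne : ∀ s, petalLoop p .mid s (of (finRotate p 0)) ≠ 1 := fun s =>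
    petalLoop_mid_of_ne_one s (finRotate_apply_ne hp2 0)
  obtain ⟨d, hd, e, he, h⟩ := exists_conj_permAction hφ (σ := (finRotate p, 1))
    finRotate_mem (one_mem _)
  obtain ⟨d', hd', e', he', h'⟩ := exists_conj_permAction hφ (σ := (1, finRotate p))
    (one_mem _) finRotate_mem
  -- The rotation of one graph fixes nontrivial loops, so its conjugate `(d, e)` cannot move every
  -- edge.
  have hde : d = 1 ∨ e = 1 := by
    by_contra! hcon
    refine hne true (φ.injective ?_)
    rw [_root_.map_one]
    refine eq_one_of_permAction_eq (σ := (d, e)) (hmove hd hcon.1) (hmove he hcon.2) ?_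
    rw [← h, permAction_petalLoop_mid true rfl]
  have hde' : d' = 1 ∨ e' = 1 := by
    by_contra! hcon
    refine hne false (φ.injective ?_)
    rw [_root_.map_one]
    refine eq_one_of_permAction_eq (σ := (d', e')) (hmove hd' hcon.1) (hmove he' hcon.2) ?_
    rw [← h', permAction_petalLoop_mid false rfl]
  have hnot : ¬(d = 1 ∧ e = 1) := by
    rintro ⟨rfl, rfl⟩
    exact hc1 (congrArg Prod.fst (eq_one_of_conj_permAction hinj h))
  have hnot' : ¬(d' = 1 ∧ e' = 1) := by
    rintro ⟨rfl, rfl⟩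
    exact hc1 (congrArg Prod.snd (eq_one_of_conj_permAction hinj h'))
  have hprod : ∀ g, φ (permAction p .mid (finRotate p, finRotate p) g) =
      permAction p .mid (d * d', e * e') (φ g) := fun g => by
    have e1 : ((finRotate p, finRotate p) : Equiv.Perm (Fin p) × Equiv.Perm (Fin p)) =
      (finRotate p, 1) * (1, finRotate p) := by simp
    rw [e1, permAction_mul_apply, h, h', ← permAction_mul_apply]; rfl
  -- The diagonal rotation fixes only `1`, hence so does its conjugate, which must therefore be
  -- nontrivial on both graphs. This excludes that both generators go to the same factor.
  have hfix : ∀ s : Bool, ¬ (if s then e * e' else d * d') = 1 := fun s hs => by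
    refine hne s ?_
    have h0 : φ⁻¹ (petalLoop p .mid s (of (finRotate p 0))) = 1 := by
      refine eq_one_of_permAction_eq (σ := (finRotate p, finRotate p)) (finRotate_apply_ne hp2)
        (finRotate_apply_ne hp2) (φ.injective ?_)
      rw [hprod, MulAut.apply_inv_self, permAction_petalLoop_mid s hs]
    exact (map_eq_one_iff _ (φ⁻¹).injective).1 h0
  have hd_or : ¬(d = 1 ∧ d' = 1) := fun hc => hfix false (by simp [hc.1, hc.2])
  have he_or : ¬(e = 1 ∧ e' = 1) := fun hc => hfix true (by simp [hc.1, hc.2])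
  rcases hde with rfl | rfl
  · have he1 : e ≠ 1 := fun h => hnot ⟨rfl, h⟩
    have hd1' : d' ≠ 1 := fun h => hd_or ⟨rfl, h⟩
    obtain rfl : e' = 1 := hde'.resolve_left hd1'
    have hswap : ∀ σ τ g, (Psi p).pi1Action (swapGraph p) (permAction p .mid (σ, τ) g) =
        permAction p .mid (τ, σ) ((Psi p).pi1Action (swapGraph p) g) := fun σ τ g => by
      have := congrArg (Psi p).pi1Action (swapGraph_mul_permuteEdges σ τ)
      rw [_root_.map_mul, _root_.map_mul] at this
      exact DFunLike.congr_fun this g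
    have hmem : (Psi p).pi1Action (swapGraph p) * φ ∈ (Psi p).pi1Action.range := by
      refine mem_range_of_conj_mid hp he he1 hd' hd1' (fun g => ?_) (fun g => ?_)
      · rw [MulAut.mul_apply, h, hswap]; rfl
      · rw [MulAut.mul_apply, h', hswap]; rfl
    have := mul_mem (inv_mem (show (Psi p).pi1Action (swapGraph p) ∈
      (Psi p).pi1Action.range from ⟨_, rfl⟩)) hmem
    rwa [inv_mul_cancel_left] at this
  · have hd1 : d ≠ 1 := fun h => hnot ⟨h, rfl⟩
    have he1' : e' ≠ 1 := fun h => he_or ⟨rfl, h⟩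
    obtain rfl : d' = 1 := hde'.resolve_right he1'
    exact mem_range_of_conj_mid hp hd hd1 he' he1' h h'

end AutFree

namespace AutFree

open FreeGroup PointedGraph

variable {p : ℕ}

/-! ### The basepoint `tip false` -/

/-- The automorphism of a free group that inverts all letters. -/
def invLetters (X : Type*) : FreeGroup X →* FreeGroup X := lift fun x => (of x)⁻¹

theorem invLetters_invLetters {X : Type*} (w : FreeGroup X) :
    invLetters X (invLetters X w) = w := by
  have : (invLetters X).comp (invLetters X) = MonoidHom.id _ :=
    ext_hom _ _ fun x => by simp [invLetters]
  exact DFunLike.congr_fun this w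

theorem invLetters_injective {X : Type*} : Function.Injective (invLetters X) :=
  Function.LeftInverse.injective invLetters_invLetters

theorem inv_commute {b : Vertex} {φ : MulAut (doubleTheta p b).pi1}
    {σ τ : Equiv.Perm (Fin p) × Equiv.Perm (Fin p)}
    (hφ : ∀ g, φ (permAction p b σ g) = permAction p b τ (φ g)) (g : (doubleTheta p b).pi1) :
    φ⁻¹ (permAction p b τ g) = permAction p b σ (φ⁻¹ g) := by
  apply φ.injective
  rw [hφ, MulAut.apply_inv_self, MulAut.apply_inv_self]

section Omega

variable [NeZero p]

/-- The loops at `tip false` in the adjacent Θ-graph, with the letters inverted so that the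
parametrization is equivariant. -/
def nearLoop (p : ℕ) [NeZero p] : FreeGroup (Fin p) →* (Omega p).pi1 :=
  (petalLoop p (.tip false) false).comp (invLetters _)

/-- The loops at `tip false` that run in the distant Θ-graph, conjugated by the edge number `0`. -/
abbrev farLoop (p : ℕ) [NeZero p] : FreeGroup (Fin p) →* (Omega p).pi1 :=
  petalLoop p (.tip false) true

theorem loopWord_nearLoop (h : FreeGroup (Fin p)) :
    loopWord p (.tip false) (nearLoop p h) = map (Prod.mk false) (invLetters _ (relHom 0 h)) := by
  refine (loopWord_toLoop _ _).trans ?_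
  have : ((collapse p (.tip false)).comp (map (Prod.mk false))).comp (invLetters _) =
      ((map (Prod.mk false)).comp (invLetters _)).comp (relHom 0) :=
    ext_hom _ _ fun i => by simp [treePath, invLetters, mul_assoc]
  exact DFunLike.congr_fun this h

theorem loopWord_farLoop (h : FreeGroup (Fin p)) :
    loopWord p (.tip false) (farLoop p h) =
      (of (false, 0))⁻¹ * map (Prod.mk true) (relHom 0 h) * of (false, 0) := by
  refine (loopWord_toLoop _ _).trans ?_
  have : (collapse p (.tip false)).comp (map (Prod.mk true)) =
      (MulAut.conj (of ((false, 0) : Bool × Fin p))⁻¹).toMonoidHom.comp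
        ((map (Prod.mk true)).comp (relHom 0)) :=
    ext_hom _ _ fun i => by simp [treePath, mul_assoc]
  exact (DFunLike.congr_fun this h).trans (by simp)

theorem nearLoop_of_zero : nearLoop p (of 0) = 1 := by
  have : invLetters (Fin p) (of 0) = (of 0)⁻¹ := lift_apply_of
  rw [nearLoop, MonoidHom.comp_apply, this, _root_.map_inv, petalLoop_of_zero, inv_one]

theorem relHom_eq_of_nearLoop_eq {h h' : FreeGroup (Fin p)} (hh : nearLoop p h = nearLoop p h') :
    relHom 0 h = relHom 0 h' := by
  have := congrArg (loopWord p (.tip false)) hh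
  rw [loopWord_nearLoop, loopWord_nearLoop] at this
  exact invLetters_injective (map_injective (Prod.mk_right_injective false) this)

theorem relHom_eq_of_farLoop_eq {h h' : FreeGroup (Fin p)} (hh : farLoop p h = farLoop p h') :
    relHom 0 h = relHom 0 h' := by
  have := congrArg (loopWord p (.tip false)) hh
  rw [loopWord_farLoop, loopWord_farLoop, mul_left_inj, mul_right_inj] at this
  exact map_injective (Prod.mk_right_injective true) this

theorem nearLoop_ne_one {i : Fin p} (hi : i ≠ 0) : nearLoop p (of i) ≠ 1 := fun h =>
  relHom_of_ne_one hi
    ((relHom_eq_of_nearLoop_eq (h.trans (_root_.map_one _).symm)).trans (_root_.map_one _))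

theorem farLoop_ne_one {i : Fin p} (hi : i ≠ 0) : farLoop p (of i) ≠ 1 := fun h =>
  relHom_of_ne_one hi
    ((relHom_eq_of_farLoop_eq (h.trans (_root_.map_one _).symm)).trans (_root_.map_one _))

theorem permAction_nearLoop {σ : Equiv.Perm (Fin p) × Equiv.Perm (Fin p)} (hσ : σ.1 = 1)
    (h : FreeGroup (Fin p)) :
    permAction p (.tip false) σ (nearLoop p h) = nearLoop p h := by
  apply loopWord_injective
  rw [loopWord_permAction, loopWord_nearLoop, map_edgePerm_mk]
  simp only [Bool.false_eq_true, if_false, hσ, map_one_perm]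

theorem exists_nearLoop_eq {σ : Equiv.Perm (Fin p) × Equiv.Perm (Fin p)}
    (h : ∀ i, σ.2 i ≠ i) {g : (Omega p).pi1} (hg : permAction p (.tip false) σ g = g) :
    ∃ h, nearLoop p h = g := by
  obtain ⟨k, hk⟩ := mem_range_map_of_map_edgePerm_eq (w := loopWord p (.tip false) g) false h
    (by rw [← loopWord_permAction, hg])
  refine ⟨invLetters _ k, ?_⟩
  rw [← toLoop_loopWord (.tip false) g, ← hk, nearLoop, MonoidHom.comp_apply,
    invLetters_invLetters]
  rfl

/-- A nontrivial loop at `tip false` must use an edge of the near graph. -/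
theorem eq_one_of_loopWord_eq_map {g : (Omega p).pi1} {k : FreeGroup (Fin p)}
    (hk : map (Prod.mk true) k = loopWord p (.tip false) g) : g = 1 := by
  classical
  have h1 := loopWord_farLoop k
  have h2 : farLoop p k = g := by
    rw [← toLoop_loopWord (.tip false) g, ← hk]; rfl
  rw [h2, ← hk] at h1
  have h3 : of (false, 0) * map (Prod.mk true) k =
      map (Prod.mk true) (relHom 0 k) * of (false, 0) := by
    rw [h1]; group
  have hinj : Function.Injective (Prod.mk true : Fin p → Bool × Fin p) :=
    Prod.mk_right_injective true
  have hword : ∀ w : FreeGroup (Fin p), map (Prod.mk true) w =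
      FreeGroup.mk (mapWord (Prod.mk true) w.toWord) := fun w => by
    rw [← map_mk_eq, mk_toWord]
  have hof : (of (false, 0) : FreeGroup (Bool × Fin p)) = FreeGroup.mk [((false, 0), true)] := rfl
  rw [hword, hword, hof, mul_mk, mul_mk] at h3
  have h4 := congrArg toWord h3
  -- Both sides are reduced, since near and far letters cannot cancel. The left one starts with a
  -- near letter, so the far word on the right is empty, and then so is the word of `k`.
  rw [toWord_mk_of_isReduced, toWord_mk_of_isReduced] at h4
  · have hk1 : k = 1 := by
      rw [← toWord_eq_nil_iff]
      rcases hw : (relHom 0 k).toWord with _ | ⟨a, L⟩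
      · rw [hw] at h4
        simpa [mapWord] using h4
      · rw [hw] at h4
        simp [mapWord] at h4
    apply loopWord_injective
    rw [← hk, hk1, _root_.map_one, _root_.map_one]
  · refine List.IsChain.append (isReduced_toWord.mapWord hinj) IsReduced.singleton ?_
    intro a ha b hb h
    have ha' := List.mem_of_mem_getLast? ha
    simp only [mapWord, List.mem_map] at ha'
    obtain ⟨x, -, rfl⟩ := ha'
    simp only [List.head?_cons, Option.mem_some_iff] at hb
    subst hb
    simp at h
  · refine List.IsChain.append IsReduced.singleton (isReduced_toWord.mapWord hinj) ?_
    intro a ha b hb h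
    have hb' := List.mem_of_mem_head? hb
    simp only [mapWord, List.mem_map] at hb'
    obtain ⟨x, -, rfl⟩ := hb'
    simp only [List.getLast?_singleton, Option.mem_some_iff] at ha
    subst ha
    simp at h

theorem eq_one_of_permAction_eq_tip {σ : Equiv.Perm (Fin p) × Equiv.Perm (Fin p)}
    (h : ∀ i, σ.1 i ≠ i) {g : (Omega p).pi1} (hg : permAction p (.tip false) σ g = g) :
    g = 1 := by
  obtain ⟨k, hk⟩ := mem_range_map_of_map_edgePerm_eq (w := loopWord p (.tip false) g) true h
    (by rw [← loopWord_permAction, hg])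
  exact eq_one_of_loopWord_eq_map hk

/-- Far loops are conjugated by edge number `0`, which `σ` moves to edge `σ 0`; the two approaches
differ by a near loop. -/
theorem permAction_farLoop_eq_conj (σ : Equiv.Perm (Fin p)) (h : FreeGroup (Fin p)) :
    permAction p (.tip false) (σ, 1) (farLoop p h) =
      nearLoop p (of (σ 0)) * farLoop p h * (nearLoop p (of (σ 0)))⁻¹ := by
  apply loopWord_injective
  rw [loopWord_permAction, _root_.map_mul, _root_.map_mul, _root_.map_inv, loopWord_farLoop,
    loopWord_nearLoop, _root_.map_mul, _root_.map_mul, map_edgePerm_mk]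
  simp only [if_true, map_one_perm, _root_.map_inv, map.of, edgePerm_false, relHom_of,
    _root_.map_mul, invLetters, lift_apply_of]
  group

/-- The rotation `(finRotate p, 1)` conjugates far loops by a near loop that `φ` fixes, so
`(finRotate p, f)` conjugates their images by the same near loop. -/
theorem exists_farLoop_eq_of_commute (hp : 2 ≤ p) {φ : MulAut (Omega p).pi1}
    {f : Equiv.Perm (Fin p)} (hf : f = 1 ∨ ∀ i, f i ≠ i)
    (hA : ∀ h, φ (nearLoop p h) = nearLoop p h)
    (hφ : ∀ g, φ (permAction p (.tip false) (finRotate p, 1) g) =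
      permAction p (.tip false) (finRotate p, f) (φ g)) :
    f = 1 ∧ ∀ h, ∃ h', farLoop p h' = φ (farLoop p h) := by
  -- Undoing the conjugation by edge number `0` turns this relation into invariance of a word. If
  -- `f` moved every edge, that word would be trivial; in any case it has only far letters.
  have hfix : ∀ h, map (edgePerm (finRotate p, f)) (of (false, 0) *
      loopWord p (.tip false) (φ (farLoop p h)) * (of (false, 0))⁻¹) =
      of (false, 0) * loopWord p (.tip false) (φ (farLoop p h)) * (of (false, 0))⁻¹ := by
    intro h
    have h1 := congrArg (loopWord p (.tip false)) (hφ (farLoop p h))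
    rw [permAction_farLoop_eq_conj, _root_.map_mul, _root_.map_mul, _root_.map_inv, hA,
      _root_.map_mul, _root_.map_mul, _root_.map_inv, loopWord_permAction,
      hA, loopWord_nearLoop] at h1
    rw [_root_.map_mul, _root_.map_mul, _root_.map_inv, ← h1]
    simp only [_root_.map_inv, map.of, edgePerm_false, relHom_of, _root_.map_mul, invLetters,
      lift_apply_of]
    group
  constructor
  · refine hf.resolve_right fun hf' => ?_
    have hne := farLoop_ne_one (finRotate_apply_ne hp (0 : Fin p))
    have h1 := eq_one_of_map_eq (c := edgePerm (finRotate p, f)) (by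
      rintro ⟨_ | _, i⟩
      · simpa using finRotate_apply_ne hp i
      · simpa using hf' i) (hfix (of (finRotate p 0)))
    rw [mul_inv_eq_one, mul_eq_left] at h1
    exact hne ((map_eq_one_iff _ φ.injective).1 ((map_eq_one_iff _ (loopWord_injective _)).1 h1))
  · intro h
    obtain ⟨k, hk⟩ := mem_range_map_of_map_edgePerm_eq true (finRotate_apply_ne hp) (hfix h)
    refine ⟨k, ?_⟩
    change toLoop p (.tip false) (map (Prod.mk true) k) = _
    rw [hk, _root_.map_mul, _root_.map_mul, _root_.map_inv, toLoop_of_zero, toLoop_loopWord]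
    simp

theorem exists_nearLoop_of_commute (hp : 2 ≤ p) {φ : MulAut (Omega p).pi1}
    (hφ : ∀ g, φ (permAction p (.tip false) (1, finRotate p) g) =
      permAction p (.tip false) (1, finRotate p) (φ g)) (h : FreeGroup (Fin p)) :
    ∃ h', nearLoop p h' = φ (nearLoop p h) := by
  refine exists_nearLoop_eq (σ := (1, finRotate p)) (finRotate_apply_ne hp) ?_
  rw [← hφ, permAction_nearLoop rfl]

theorem mem_range_of_fix_nearLoop (hp : 2 ≤ p) {φ : MulAut (Omega p).pi1}
    {f : Equiv.Perm (Fin p)} (hf : f = 1 ∨ ∀ i, f i ≠ i)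
    (hA : ∀ h, φ (nearLoop p h) = nearLoop p h)
    (h1 : ∀ g, φ (permAction p (.tip false) (finRotate p, 1) g) =
      permAction p (.tip false) (finRotate p, f) (φ g))
    (h2 : ∀ g, φ (permAction p (.tip false) (1, finRotate p) g) =
      permAction p (.tip false) (1, finRotate p) (φ g)) :
    φ ∈ (Omega p).pi1Action.range := by
  obtain ⟨rfl, hB⟩ := exists_farLoop_eq_of_commute hp hf hA h1
  obtain ⟨-, hB'⟩ := exists_farLoop_eq_of_commute hp (φ := φ⁻¹) (Or.inl rfl)
    (fun h => φ.injective (by rw [MulAut.apply_inv_self, hA])) (inv_commute h1)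
  obtain ⟨n, hn⟩ := exists_apply_eq_iterate_of_commute (c := finRotate p) (orderOf_pos _)
    (pow_orderOf_eq_one _) (exists_finRotate_pow_eq hp) (x₀ := 0) (finRotate_apply_ne hp 0)
    (E := farLoop p) (petalLoop_of_zero _ _) (fun h h' => relHom_eq_of_farLoop_eq)
    (φ := φ.toMonoidHom) (α := (permAction p (.tip false) (1, finRotate p)).toMonoidHom)
    (fun i => by
      apply loopWord_injective
      change _ = loopWord p (.tip false)
        (permAction p (.tip false) (1, finRotate p) (farLoop p (of i)))
      rw [loopWord_permAction, loopWord_farLoop, loopWord_farLoop]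
      simp [mul_assoc])
    (fun h => h2 _) hB
    (fun h => by
      obtain ⟨h', hh'⟩ := hB' h
      refine ⟨h', ?_⟩
      rw [hh']
      exact φ.apply_symm_apply _)
  refine ⟨permuteEdges p _ (1, finRotate p ^ n), ?_⟩
  change permAction p (.tip false) (1, finRotate p ^ n) = φ
  refine mulAut_ext_of_toLoop ?_
  rintro ⟨_ | _, i⟩
  · have e : toLoop p (.tip false) (of (false, i)) = (nearLoop p (of i))⁻¹ := by
      simp [nearLoop, petalLoop, invLetters]
    rw [e, _root_.map_inv, _root_.map_inv, hA, permAction_nearLoop rfl]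
  · refine Eq.trans ?_ (hn (of i)).symm
    rw [iterate_permAction]
    simp [petalLoop]

theorem mem_range_of_commute_tip (hp : 2 ≤ p) {φ : MulAut (Omega p).pi1}
    {f : Equiv.Perm (Fin p)} (hf : f = 1 ∨ ∀ i, f i ≠ i)
    (h1 : ∀ g, φ (permAction p (.tip false) (finRotate p, 1) g) =
      permAction p (.tip false) (finRotate p, f) (φ g))
    (h2 : ∀ g, φ (permAction p (.tip false) (1, finRotate p) g) =
      permAction p (.tip false) (1, finRotate p) (φ g)) :
    φ ∈ (Omega p).pi1Action.range := by
  -- The still unknown far component `f` is invisible on near loops, so `φ` commutes there with the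
  -- near rotation.
  have hα : ∀ τ : Equiv.Perm (Fin p), ∀ h,
      permAction p (.tip false) (finRotate p, τ) (nearLoop p h) =
      permAction p (.tip false) (finRotate p, 1) (nearLoop p h) := fun τ h => by
    have e : ((finRotate p, τ) : Equiv.Perm (Fin p) × Equiv.Perm (Fin p)) =
        (finRotate p, 1) * (1, τ) := by simp
    rw [e, permAction_mul_apply, permAction_nearLoop rfl]
  have hA := exists_nearLoop_of_commute hp h2
  obtain ⟨n, hn⟩ := exists_apply_eq_iterate_of_commute (c := finRotate p) (orderOf_pos _)
    (pow_orderOf_eq_one _) (exists_finRotate_pow_eq hp) (x₀ := 0) (finRotate_apply_ne hp 0)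
    (E := nearLoop p) nearLoop_of_zero (fun h h' => relHom_eq_of_nearLoop_eq)
    (φ := φ.toMonoidHom) (α := (permAction p (.tip false) (finRotate p, 1)).toMonoidHom)
    (fun i => by
      apply loopWord_injective
      change _ = loopWord p (.tip false)
        (permAction p (.tip false) (finRotate p, 1) (nearLoop p (of i)))
      rw [loopWord_permAction, loopWord_nearLoop, loopWord_nearLoop, map_edgePerm_mk]
      simp [invLetters])
    (fun h => by
      obtain ⟨h', hh'⟩ := hA h
      refine (h1 _).trans ?_
      rw [← hh', hα]
      exact congrArg _ hh')
    hA
    (fun h => by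
      obtain ⟨h', hh'⟩ := exists_nearLoop_of_commute hp (φ := φ⁻¹) (inv_commute h2) h
      refine ⟨h', ?_⟩
      rw [hh']
      exact φ.apply_symm_apply _)
  have hcomm : ∀ τ : Equiv.Perm (Fin p) × Equiv.Perm (Fin p), Commute τ.1 (finRotate p) →
      τ * (finRotate p ^ n, 1) = (finRotate p ^ n, 1) * τ := fun τ hτ =>
    Prod.ext (hτ.pow_right n).eq (by simp)
  refine mul_permAction_mem_range (finRotate p ^ n, 1) (mem_range_of_fix_nearLoop hp hf ?_
    (conj_inv_mul_apply (hcomm _ (Commute.refl _)) h1)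
    (conj_inv_mul_apply (hcomm _ (Commute.one_left _)) h2))
  intro h
  apply (permAction p (.tip false) (finRotate p ^ n, 1)).injective
  rw [MulAut.mul_apply, MulAut.apply_inv_self]
  refine (hn h).trans ?_
  rw [iterate_permAction, Prod.pow_mk, one_pow]

theorem permAction_injective_tip (hp : 2 ≤ p) :
    Function.Injective (permAction p (.tip false)) :=
  (pi1Action_injective_Omega hp).comp (permuteEdges_injective _)

end Omega

theorem mem_range_of_mem_normalizer_tip (hp : p.Prime) {φ : MulAut (Omega p).pi1}
    (hφ : φ ∈ Subgroup.normalizer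
      ((rotations p (.tip false)).map (Omega p).pi1Action : Set (MulAut (Omega p).pi1))) :
    φ ∈ (Omega p).pi1Action.range := by
  have : NeZero p := ⟨hp.ne_zero⟩
  have hp2 := hp.two_le
  have hinj := permAction_injective_tip hp2
  have hmove := fun {d : Equiv.Perm (Fin p)} (hd : d ∈ cyclicSubgroup p) (h1 : d ≠ 1) =>
    apply_ne_of_mem_cyclicSubgroup hp2 hd h1
  have hne : nearLoop p (of (finRotate p 0)) ≠ 1 := nearLoop_ne_one (finRotate_apply_ne hp2 0)
  obtain ⟨d, hd, e, he, h⟩ := exists_conj_permAction hφ (σ := (finRotate p, 1))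
    finRotate_mem (one_mem _)
  obtain ⟨d', hd', e', he', h'⟩ := exists_conj_permAction hφ (σ := (1, finRotate p))
    (one_mem _) finRotate_mem
  -- The far rotation fixes near loops, but anything that rotates the near graph fixes only `1`.
  obtain rfl : d' = 1 := by
    by_contra hcon
    refine hne ((map_eq_one_iff _ φ.injective).1
      (eq_one_of_permAction_eq_tip (σ := (d', e')) (hmove hd' hcon) ?_))
    rw [← h', permAction_nearLoop rfl]
  have he1 : e' ≠ 1 := by
    rintro rfl
    exact finRotate_ne_one hp2 (congrArg Prod.snd (eq_one_of_conj_permAction hinj h'))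
  have hd1 : d ≠ 1 := by
    rintro rfl
    refine hne ((map_eq_one_iff _ (φ⁻¹).injective).1
      (eq_one_of_permAction_eq_tip (σ := (finRotate p, 1)) (finRotate_apply_ne hp2) ?_))
    rw [← inv_commute h, permAction_nearLoop rfl]
  obtain ⟨σ, hσ⟩ := exists_conj_finRotate hp hd hd1
  obtain ⟨τ, hτ⟩ := exists_conj_finRotate hp he' he1
  -- After conjugation `e'` becomes the rotation itself, and `e` commutes with `e'`. The component
  -- `f` is thus trivial or without fixed points.
  have hf : Commute (τ⁻¹ * e * τ) (finRotate p) := by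
    have e1 : finRotate p = τ⁻¹ * e' * τ := by rw [mul_assoc, hτ]; group
    rw [e1]
    have := (commute_of_mem_cyclicSubgroup he he').eq
    change τ⁻¹ * e * τ * (τ⁻¹ * e' * τ) = τ⁻¹ * e' * τ * (τ⁻¹ * e * τ)
    calc _ = τ⁻¹ * (e * e') * τ := by group
      _ = τ⁻¹ * (e' * e) * τ := by rw [this]
      _ = _ := by group
  refine mul_permAction_mem_range (σ, τ) (mem_range_of_commute_tip hp2
    (f := τ⁻¹ * e * τ) ?_ (conj_inv_mul_apply (Prod.ext hσ ?_) h)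
    (conj_inv_mul_apply (Prod.ext ?_ hτ) h'))
  · by_contra! hcon
    obtain ⟨hf1, i, hi⟩ := hcon
    exact hf1 (eq_one_of_commute_finRotate hp2 hf hi)
  · change e * τ = τ * (τ⁻¹ * e * τ)
    group
  · simp

end AutFree

namespace AutFree

open PointedGraph

variable {p : ℕ}

/-! ### Normalizers -/

/-- Since `f` is injective, the preimage of the normalizer of `H.map f` is the normalizer of `H`;
nothing is lost when the former lies in the range. -/
theorem normalizer_map_eq_of_le_range {G G' : Type*} [Group G] [Group G'] {f : G →* G'}
    (hf : Function.Injective f) {H : Subgroup G}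
    (h : Subgroup.normalizer (H.map f : Set G') ≤ f.range) :
    Subgroup.normalizer (H.map f : Set G') = (Subgroup.normalizer (H : Set G)).map f := by
  have h1 := Subgroup.comap_normalizer_eq_of_le_range (f := f) (H := H.map f)
    (Subgroup.map_le_range f H)
  rw [Subgroup.comap_map_eq_self_of_injective hf] at h1
  rw [← h1, Subgroup.map_comap_eq_self h]

theorem normalizer_prod {G G' : Type*} [Group G] [Group G'] (H : Subgroup G) (K : Subgroup G') :
    Subgroup.normalizer (H.prod K : Set (G × G')) =
      (Subgroup.normalizer (H : Set G)).prod (Subgroup.normalizer (K : Set G')) := by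
  ext x
  rw [Subgroup.mem_prod, Subgroup.mem_normalizer_iff, Subgroup.mem_normalizer_iff,
    Subgroup.mem_normalizer_iff]
  simp only [Subgroup.mem_prod, Prod.forall, Prod.fst_mul, Prod.snd_mul, Prod.fst_inv,
    Prod.snd_inv]
  constructor
  · intro h
    exact ⟨fun g => by simpa using h g 1, fun g => by simpa using h 1 g⟩
  · rintro ⟨h1, h2⟩ g g'
    rw [← h1, ← h2]

theorem PointedGraph.Marking.realize_injective {Γ : PointedGraph} {n : ℕ} (μ : Γ.Marking n)
    (h : Function.Injective Γ.pi1Action) : Function.Injective μ.realize :=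
  (MulAut.congr μ.symm).injective.comp h

theorem PointedGraph.Marking.normalizer_map_realize {Γ : PointedGraph} {n : ℕ}
    (μ : Γ.Marking n) (hinj : Function.Injective Γ.pi1Action) (R : Subgroup Γ.autGroup)
    (h : ∀ φ ∈ Subgroup.normalizer (R.map Γ.pi1Action : Set (MulAut Γ.pi1)),
      φ ∈ Γ.pi1Action.range) :
    Subgroup.normalizer (R.map μ.realize : Set (MulAut (FreeGroup (Fin n)))) =
      (Subgroup.normalizer (R : Set Γ.autGroup)).map μ.realize := by
  refine normalizer_map_eq_of_le_range (μ.realize_injective hinj) ?_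
  rw [Marking.realize, ← Subgroup.map_map, ← Subgroup.map_equiv_normalizer_eq]
  rintro _ ⟨φ, hφ, rfl⟩
  obtain ⟨σ, rfl⟩ := h φ hφ
  exact ⟨σ, rfl⟩

/-! ### The normalizer inside the group of graph automorphisms -/

theorem mem_range_permuteEdges [NeZero p] {b : Vertex} {σ : (doubleTheta p b).autGroup}
    (h : ∀ v, σ.1.1 v = v) : σ ∈ (permuteEdges p b).range := by
  have hedge : ∀ s i, ∃ j, σ.1.2 (s, i, false) = (s, j, false) := by
    intro s i
    have h1 : (doubleTheta p b).init (σ.1.2 (s, i, false)) = Vertex.mid :=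
      (σ.2.1 (s, i, false)).trans (h _)
    have h2 : (doubleTheta p b).init ((doubleTheta p b).rev (σ.1.2 (s, i, false))) =
        Vertex.tip s :=
      (congrArg _ (σ.2.2.1 (s, i, false))).trans ((σ.2.1 (s, i, true)).trans (h _))
    rcases he : σ.1.2 (s, i, false) with ⟨s', j, o⟩
    rw [he] at h1 h2
    cases o with
    | true => simp at h1
    | false =>
      simp only [Bool.not_false, if_true, Vertex.tip.injEq] at h2
      exact ⟨j, by rw [h2]⟩
  choose f hf using hedge
  have hbij : ∀ s, Function.Bijective (f s) := fun s => by
    refine Finite.injective_iff_bijective.1 fun i j hij => ?_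
    have := σ.1.2.injective ((hf s i).trans ((congrArg (fun k => (s, k, false)) hij).trans
      (hf s j).symm))
    simpa using this
  refine ⟨(Equiv.ofBijective _ (hbij false), Equiv.ofBijective _ (hbij true)),
    autGroup_ext_edges fun s i => ?_⟩
  rw [hf]
  cases s <;> rfl

theorem permuteEdges_mem_normalizer (b : Vertex)
    {σ : Equiv.Perm (Fin p) × Equiv.Perm (Fin p)} (h1 : σ.1 ∈ normCyclic p)
    (h2 : σ.2 ∈ normCyclic p) :
    permuteEdges p b σ ∈ Subgroup.normalizer (rotations p b : Set (doubleTheta p b).autGroup) := by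
  refine Subgroup.le_normalizer_map _ ⟨σ, ?_, rfl⟩
  rw [normalizer_prod]
  exact ⟨h1, h2⟩

theorem mem_normCyclic_of_permuteEdges_mem {b : Vertex}
    {σ : Equiv.Perm (Fin p) × Equiv.Perm (Fin p)}
    (h : permuteEdges p b σ ∈
      Subgroup.normalizer (rotations p b : Set (doubleTheta p b).autGroup)) :
    σ.1 ∈ normCyclic p ∧ σ.2 ∈ normCyclic p := by
  have h1 : σ ∈ (Subgroup.normalizer
      (rotations p b : Set (doubleTheta p b).autGroup)).comap (permuteEdges p b) := h
  rw [rotations, Subgroup.comap_normalizer_eq_of_le_range (Subgroup.map_le_range _ _),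
    Subgroup.comap_map_eq_self_of_injective (permuteEdges_injective b), normalizer_prod] at h1
  exact h1

/-- The basepoint is fixed, `mid` is its only neighbour, and one vertex remains. -/
theorem vertex_fixed_of_tip {σ : (Omega p).autGroup} [NeZero p] (v : Vertex) : σ.1.1 v = v := by
  have h0 : σ.1.1 (.tip false) = .tip false := σ.2.2.2
  have h1 : σ.1.1 .mid = .mid := by
    have h2 : (Omega p).init (σ.1.2 (false, 0, true)) = .tip false :=
      (σ.2.1 (false, 0, true)).trans h0
    have h3 : (Omega p).init ((Omega p).rev (σ.1.2 (false, 0, true))) = σ.1.1 .mid :=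
      (congrArg _ (σ.2.2.1 (false, 0, true))).trans (σ.2.1 (false, 0, false))
    rw [← h3]
    rcases he : σ.1.2 (false, 0, true) with ⟨s', j, o⟩
    rw [he] at h2
    cases o with
    | false => simp at h2
    | true => simp
  rcases v with _ | _ | _
  · exact h1
  · exact h0
  · rcases hv : σ.1.1 (.tip true) with _ | _ | _
    · exact absurd (σ.1.1.injective (hv.trans h1.symm)) (by simp)
    · exact absurd (σ.1.1.injective (hv.trans h0.symm)) (by simp)
    · rfl

/-- The normalizer of the rotations in the automorphism group of `Ω`. -/
theorem nonempty_normalizer_rotations_Omega [NeZero p] :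
    Nonempty (Subgroup.normalizer (rotations p (.tip false) : Set (Omega p).autGroup) ≃*
      normCyclic p × normCyclic p) := by
  let f : normCyclic p × normCyclic p →* (Omega p).autGroup :=
    (permuteEdges p (.tip false)).comp ((normCyclic p).subtype.prodMap (normCyclic p).subtype)
  have hf : Function.Injective f := (permuteEdges_injective _).comp
    (Subtype.val_injective.prodMap Subtype.val_injective)
  have hrange : f.range =
      Subgroup.normalizer (rotations p (.tip false) : Set (Omega p).autGroup) := by
    ext σ
    constructor
    · rintro ⟨τ, rfl⟩
      exact permuteEdges_mem_normalizer _ τ.1.2 τ.2.2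
    · intro hσ
      obtain ⟨τ, rfl⟩ := mem_range_permuteEdges (σ := σ) vertex_fixed_of_tip
      obtain ⟨h1, h2⟩ := mem_normCyclic_of_permuteEdges_mem hσ
      exact ⟨(⟨τ.1, h1⟩, ⟨τ.2, h2⟩), rfl⟩
  exact ⟨((MonoidHom.ofInjective hf).trans (MulEquiv.subgroupCongr hrange)).symm⟩

theorem swapGraph_mem_normalizer :
    swapGraph p ∈ Subgroup.normalizer (rotations p .mid : Set (Psi p).autGroup) := by
  have hconj : ∀ σ τ, swapGraph p * permuteEdges p .mid (σ, τ) * (swapGraph p)⁻¹ =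
      permuteEdges p .mid (τ, σ) := fun σ τ => by
    rw [swapGraph_mul_permuteEdges, mul_inv_cancel_right]
  have hinv : (swapGraph p)⁻¹ = swapGraph p := inv_eq_of_mul_eq_one_left swapGraph_mul_self
  have key : ∀ h ∈ rotations p .mid, swapGraph p * h * (swapGraph p)⁻¹ ∈ rotations p .mid := by
    rintro _ ⟨⟨σ, τ⟩, ⟨h1, h2⟩, rfl⟩
    rw [hconj]
    exact ⟨(τ, σ), ⟨h2, h1⟩, rfl⟩
  refine Subgroup.mem_normalizer_iff.2 fun h => ⟨key h, fun hh => ?_⟩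
  have := key _ hh
  rw [hinv] at this
  have e : swapGraph p * (swapGraph p * h * swapGraph p) * swapGraph p =
      (swapGraph p * swapGraph p) * h * (swapGraph p * swapGraph p) := by group
  rwa [e, swapGraph_mul_self, one_mul, mul_one] at this

/-- The subgroup of order two generated by the graph automorphism that exchanges the two
Θ-graphs. -/
def swapHom (p : ℕ) : Multiplicative (ZMod 2) →* (Psi p).autGroup where
  toFun a := if a = 1 then 1 else swapGraph p
  map_one' := if_pos rfl
  map_mul' a b := by
    have key : ∀ a b : Multiplicative (ZMod 2), (a = 1 ∧ b = 1 ∧ a * b = 1) ∨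
        (a = 1 ∧ b ≠ 1 ∧ a * b ≠ 1) ∨ (a ≠ 1 ∧ b = 1 ∧ a * b ≠ 1) ∨
        (a ≠ 1 ∧ b ≠ 1 ∧ a * b = 1) := by decide
    rcases key a b with ⟨h1, h2, h3⟩ | ⟨h1, h2, h3⟩ | ⟨h1, h2, h3⟩ | ⟨h1, h2, h3⟩ <;>
      simp only [h1, h2, h3, if_true, if_false, one_mul, mul_one]
    exact swapGraph_mul_self.symm

theorem swapHom_of_ne_one {a : Multiplicative (ZMod 2)} (ha : a ≠ 1) :
    swapHom p a = swapGraph p :=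
  if_neg ha

theorem vertex_fixed_of_mid {σ : (Psi p).autGroup} (h : σ.1.1 (.tip false) = .tip false)
    (v : Vertex) : σ.1.1 v = v := by
  have h1 : σ.1.1 .mid = .mid := σ.2.2.2
  rcases v with _ | _ | _
  · exact h1
  · exact h
  · rcases hv : σ.1.1 (.tip true) with _ | _ | _
    · exact absurd (σ.1.1.injective (hv.trans h1.symm)) (by simp)
    · exact absurd (σ.1.1.injective (hv.trans h.symm)) (by simp)
    · rfl

/-- The normalizer of the rotations in the automorphism group of `Ψ`. -/
theorem nonempty_normalizer_rotations_Psi [NeZero p] :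
    Nonempty (Subgroup.normalizer (rotations p .mid : Set (Psi p).autGroup) ≃*
      (normCyclic p × normCyclic p) ⋊[swapAction (normCyclic p)] Multiplicative (ZMod 2)) := by
  let f₁ : normCyclic p × normCyclic p →* (Psi p).autGroup :=
    (permuteEdges p .mid).comp ((normCyclic p).subtype.prodMap (normCyclic p).subtype)
  have hf₁ : Function.Injective f₁ := (permuteEdges_injective _).comp
    (Subtype.val_injective.prodMap Subtype.val_injective)
  let f : (normCyclic p × normCyclic p) ⋊[swapAction (normCyclic p)] Multiplicative (ZMod 2) →*
      (Psi p).autGroup := SemidirectProduct.lift f₁ (swapHom p) fun a => by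
    refine MonoidHom.ext fun x => ?_
    change f₁ (swapAction (normCyclic p) a x) = swapHom p a * f₁ x * (swapHom p a)⁻¹
    by_cases ha : a = 1
    · rw [ha]; simp
    · have e1 : swapHom p a = swapGraph p := swapHom_of_ne_one ha
      have e2 : swapAction (normCyclic p) a x = (x.2, x.1) := by
        have : swapAction (normCyclic p) a = MulEquiv.prodComm := if_neg ha
        rw [this]; rfl
      rw [e1, e2, eq_mul_inv_iff_mul_eq]
      exact (swapGraph_mul_permuteEdges _ _).symm
  have hfapp : ∀ x, f x = f₁ x.left * swapHom p x.right := fun x => rfl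
  have hf : Function.Injective f := by
    rw [injective_iff_map_eq_one]
    intro x hx
    rw [hfapp] at hx
    have hr : x.right = 1 := by
      by_contra hr
      -- A nontrivial `ℤ/2`-component moves `tip false`, which permutations of edges fix.
      have e1 : swapHom p x.right = swapGraph p := swapHom_of_ne_one hr
      rw [e1] at hx
      have := congrArg (fun σ : (Psi p).autGroup => σ.1.1 (Vertex.tip false)) hx
      exact absurd this (by
        change Vertex.tip true ≠ Vertex.tip false
        simp)
    rw [hr, map_one, mul_one] at hx
    exact SemidirectProduct.ext ((map_eq_one_iff _ hf₁).1 hx) hr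
  have hrange : f.range = Subgroup.normalizer (rotations p .mid : Set (Psi p).autGroup) := by
    have hle : f.range ≤ Subgroup.normalizer (rotations p .mid : Set (Psi p).autGroup) := by
      rintro _ ⟨x, rfl⟩
      rw [hfapp]
      refine mul_mem (permuteEdges_mem_normalizer _ x.left.1.2 x.left.2.2) ?_
      by_cases hr : x.right = 1
      · rw [hr, map_one]; exact one_mem _
      · have e1 : swapHom p x.right = swapGraph p := swapHom_of_ne_one hr
        rw [e1]; exact swapGraph_mem_normalizer
    have hfix : ∀ σ ∈ Subgroup.normalizer (rotations p .mid : Set (Psi p).autGroup),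
        σ.1.1 (.tip false) = .tip false → σ ∈ f.range := by
      intro σ hσ h
      obtain ⟨τ, rfl⟩ := mem_range_permuteEdges (vertex_fixed_of_mid h)
      obtain ⟨h1, h2⟩ := mem_normCyclic_of_permuteEdges_mem hσ
      exact ⟨SemidirectProduct.inl (⟨τ.1, h1⟩, ⟨τ.2, h2⟩), SemidirectProduct.lift_inl _ _ _ _⟩
    have hswap : swapGraph p ∈ f.range := by
      refine ⟨SemidirectProduct.inr (Multiplicative.ofAdd 1),
        (SemidirectProduct.lift_inr _ _ _ _).trans (swapHom_of_ne_one (by decide))⟩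
    refine le_antisymm hle fun σ hσ => ?_
    have h1 : σ.1.1 .mid = .mid := σ.2.2.2
    rcases hv : σ.1.1 (.tip false) with _ | _ | _
    · exact absurd (σ.1.1.injective (hv.trans h1.symm)) (by simp)
    · exact hfix σ hσ hv
    · have h2 : swapGraph p * σ ∈ f.range := by
        refine hfix _ (mul_mem swapGraph_mem_normalizer hσ) ?_
        change (swapGraph p).1.1 (σ.1.1 (.tip false)) = _
        rw [hv]; rfl
      have := mul_mem hswap h2
      rwa [← mul_assoc, swapGraph_mul_self, one_mul] at this
  exact ⟨((MonoidHom.ofInjective hf).trans (MulEquiv.subgroupCongr hrange)).symm⟩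

/-- The normalizer of a group of realized graph automorphisms, if all its elements are
graph automorphisms. -/
theorem normalizer_realize_structure {Γ : PointedGraph} {n : ℕ} (μ : Γ.Marking n)
    (hinj : Function.Injective Γ.pi1Action) (R : Subgroup Γ.autGroup)
    (h : ∀ φ ∈ Subgroup.normalizer (R.map Γ.pi1Action : Set (MulAut Γ.pi1)),
      φ ∈ Γ.pi1Action.range) {H : Type*} [Group H] [Finite H]
    (hH : Nonempty (Subgroup.normalizer (R : Set Γ.autGroup) ≃* H)) :
    Finite (Subgroup.normalizer (R.map μ.realize : Set (MulAut (FreeGroup (Fin n))))) ∧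
    Subgroup.normalizer (R.map μ.realize : Set (MulAut (FreeGroup (Fin n)))) =
      (Subgroup.normalizer (R : Set Γ.autGroup)).map μ.realize ∧
    Nonempty (Subgroup.normalizer (R.map μ.realize : Set (MulAut (FreeGroup (Fin n)))) ≃* H) := by
  have h1 := μ.normalizer_map_realize hinj R h
  obtain ⟨e⟩ := hH
  have e' := ((MulEquiv.subgroupCongr h1).trans
    (Subgroup.equivMapOfInjective _ _ (μ.realize_injective hinj)).symm).trans e
  exact ⟨Finite.of_equiv _ e'.symm.toEquiv, h1, ⟨e'⟩⟩

end AutFree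

/-! ### The main theorem -/

theorem lemma5p8 (p n : ℕ) (hp : p.Prime) (hp2 : p ≠ 2) (hn : n = 2 * (p - 1)) :
    (Nonempty ((AutFree.Omega p).Marking n) ∧ Nonempty ((AutFree.Psi p).Marking n)) ∧
    (∀ μ : (AutFree.Omega p).Marking n,
      Finite (Subgroup.normalizer
        (AutFree.subgroupD p μ : Set (MulAut (FreeGroup (Fin n))))) ∧
      Subgroup.normalizer (AutFree.subgroupD p μ : Set (MulAut (FreeGroup (Fin n)))) =
        (Subgroup.normalizer (AutFree.rotations p (AutFree.Vertex.tip false) :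
          Set (AutFree.Omega p).autGroup)).map μ.realize ∧
      Nonempty (Subgroup.normalizer
          (AutFree.subgroupD p μ : Set (MulAut (FreeGroup (Fin n)))) ≃*
        AutFree.normCyclic p × AutFree.normCyclic p)) ∧
    (∀ μ : (AutFree.Psi p).Marking n,
      Finite (Subgroup.normalizer
        (AutFree.subgroupE p μ : Set (MulAut (FreeGroup (Fin n))))) ∧
      Subgroup.normalizer (AutFree.subgroupE p μ : Set (MulAut (FreeGroup (Fin n)))) =
        (Subgroup.normalizer (AutFree.rotations p AutFree.Vertex.mid :
          Set (AutFree.Psi p).autGroup)).map μ.realize ∧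
      Nonempty (Subgroup.normalizer
          (AutFree.subgroupE p μ : Set (MulAut (FreeGroup (Fin n)))) ≃*
        (AutFree.normCyclic p × AutFree.normCyclic p)
          ⋊[AutFree.swapAction (AutFree.normCyclic p)] Multiplicative (ZMod 2))) := by
  have : NeZero p := ⟨hp.ne_zero⟩
  refine ⟨?_, fun μ => ?_, fun μ => ?_⟩
  · obtain ⟨m, rfl⟩ := Nat.exists_eq_succ_of_ne_zero hp.ne_zero
    rw [hn]
    exact ⟨AutFree.nonempty_marking m _, AutFree.nonempty_marking m _⟩
  · exact AutFree.normalizer_realize_structure μ (AutFree.pi1Action_injective_Omega hp.two_le) _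
      (fun _ => AutFree.mem_range_of_mem_normalizer_tip hp)
      AutFree.nonempty_normalizer_rotations_Omega
  · have : Finite ((AutFree.normCyclic p × AutFree.normCyclic p)
        ⋊[AutFree.swapAction (AutFree.normCyclic p)] Multiplicative (ZMod 2)) :=
      Finite.of_equiv _ SemidirectProduct.equivProd.symm
    exact AutFree.normalizer_realize_structure μ (AutFree.pi1Action_injective_Psi hp.two_le) _
      (fun _ => AutFree.mem_range_of_mem_normalizer_mid hp)
      AutFree.nonempty_normalizer_rotations_Psi
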